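/- **Setting.** Let $a<b$, $N\in\mathbb N$, $n=(n_0,\dots,n_N)\in\mathbb N^{N+1}$, $n_{\hat x}=\sum_i n_i$, $n_S=\sum_i i\,n_i$, $n_{\mathcal F}=\sum_i (i+1)n_i$, and let $n_x,n_w,n_u,n_z,n_y,n_v,n_r,n_{BC}\in\mathbb N$. $W_k[a,b]$ is the set of functions on $[a,b]$ whose derivatives of order $<k$ are absolutely continuous and whose derivatives of order $\le k$ are in $L_2[a,b]$, and $W^n=\prod_{i=0}^N W_i^{n_i}[a,b]$. For $\hat x=(\hat x_0,\dots,\hat x_N)\in W^n$ let $\mathcal F\hat x$ collect all $\partial_s^j\hat x_i$, $0\le j\le i\le N$ (grouped by $j$, then by $i$), let $\mathcal C\hat x$ collect those with $j<i$, let $\mathcal B\hat x=((\mathcal C\hat x)(a),(\mathcal C\hat x)(b))$, and let $\mathcal D\hat x=(\partial_s^i\hat x_i)_{i=0}^N$. The norms are $$\|(x,\hat x)\|_{\mathbb R\times W^n}=|x|+\sum_{i=0}^N\sum_{j=0}^i\|\partial_s^j\hat x_i\|_{L_2},\qquad \|(x,f)\|_{\mathbb RL_2}=\big(|x|^2+\|f\|_{L_2}^2\big)^{1/2},\quad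 \mathbb RL_2^{m,p}=\mathbb R^m\times L_2^p[a,b].$$ $L_{2e}$ is the set of functions on $\mathbb R_+$ that are square integrable on every $[0,T]$; $W_{1e}$ is the set of locally absolutely continuous functions that lie in $L_{2e}$ together with their derivative. **GPDE.** The parameters are real matrices $G_o=\{A,B_{xw},B_{xu},B_{xr},C_z,D_{zw},D_{zu},D_{zr},C_y,D_{yw},D_{yu},D_{yr},C_v,D_{vw},D_{vu}\}$; $G_b=\{B,B_I,B_v\}$ with matrices $B\in\mathbb R^{n_{BC}\times 2n_S}$, $B_v\in\mathbb R^{n_{BC}\times n_v}$ and $B_I\in L_2([a,b];\mathbb R^{n_{BC}\times n_{\mathcal F}})$; and $G_p=\{A_0,A_1,A_2,B_{xv},B_{xb},C_r,D_{rb}\}$ with a constant matrix $D_{rb}$ and measurable, essentially bounded $A_0,B_{xv},B_{xb},C_r$ on $[a,b]$ and $A_1,A_2$ on $[a,b]^2$. Let $$X_v=\Big\{\hat x\in W^n:\ \int_a^bB_I(s)(\mathcal F\hat x)(s)\,ds+B_vv-B\,\mathcal B\hat x=0\Big\},\quad \mathcal X_{w,u}=\big\{(x,\hat x)\in\mathbb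 R^{n_x}\times W^n:\ \hat x\in X_{C_vx+D_{vw}w+D_{vu}u}\big\}.$$ Let $w,u\in L_{2e}$ with $B_vD_{vw}w,\,B_vD_{vu}u\in W_{1e}$. Then $\{x,\hat x,z,y,v,r\}$ *satisfies the GPDE* with initial condition $(x^0,\hat x^0)\in\mathcal X_{w(0),u(0)}$ and input $\{w,u\}$ if $z,y,v\in L_{2e}$; $(x(t),\hat x(t))\in\mathcal X_{w(t),u(t)}$ for all $t\ge0$; $t\mapsto x(t)\in\mathbb R^{n_x}$ and $t\mapsto\hat x(t)\in L_2^{n_{\hat x}}[a,b]$ are locally absolutely continuous on $\mathbb R_+$ and differentiable almost everywhere; $x(0)=x^0$, $\hat x(0)=\hat x^0$; and for almost all $t\ge 0$ $$\dot x=Ax+B_{xw}w+B_{xu}u+B_{xr}r,\quad z=C_zx+D_{zw}w+D_{zu}u+D_{zr}r,\quad y=C_yx+D_{yw}w+D_{yu}u+D_{yr}r,\quad v=C_vx+D_{vw}w+D_{vu}u,$$ $$\partial_t\hat x(t,s)=A_0(s)(\mathcal F\hat x)(t,s)+B_{xv}(s)v+B_{xb}(s)\mathcal B\hat x(t)+\int_a^sA_1(s,\theta)(\mathcal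 F\hat x)(t,\theta)d\theta+\int_s^bA_2(s,\theta)(\mathcal F\hat x)(t,\theta)d\theta,$$ $$r(t)=D_{rb}\mathcal B\hat x(t)+\int_a^bC_r(\theta)(\mathcal F\hat x)(t,\theta)d\theta .$$ **Admissibility.** Let $\tau_j(s)=s^j/j!$. For each scalar component of the block $\hat x_i$, $T(s)\in\mathbb R^{n_S\times n_S}$ has at the derivative orders $j\le j'<i$ (row $j$, column $j'$) of that component the entry $\tau_{j'-j}(s)$, $Q(s)\in\mathbb R^{n_S\times n_{\hat x}}$ has at (order $j<i$ of that component, that component) the entry $\tau_{i-j-1}(s)$, and all other entries vanish. $T_1,Q_1$ are the rows of $T,Q$ at derivative order $0$. $U_1,U_2$ are the $0$–$1$ matrices with $\mathcal F\hat x=U_1\mathcal D\hat x+U_2\mathcal C\hat x$. Put $$B_T=B\begin{bmatrix}T(0)\\T(b-a)\end{bmatrix}-\int_a^bB_I(s)U_2T(s-a)\,ds .$$ The GPDE is *admissible* if $B_T$ is invertible (in particular square, $n_{BC}=n_S$). In this case put $$B_Q(s)=B_T^{-1}\Big(B_I(s)U_1+\int_s^bB_I(\theta)U_2Q(\theta-s)d\theta-B\begin{bmatrix}0\\Q(b-s)\end{bmatrix}\Big),$$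 $$G_0=\begin{bmatrix}I_{n_0}&0\\0&0\end{bmatrix},\quad G_2(s,\theta)=\begin{bmatrix}0\\T_1(s-a)B_Q(\theta)\end{bmatrix},\quad G_1(s,\theta)=\begin{bmatrix}0\\Q_1(s-\theta)\end{bmatrix}+G_2(s,\theta),\quad G_v(s)=\begin{bmatrix}0\\T_1(s-a)B_T^{-1}B_v\end{bmatrix}.$$ **Associated PIE.** The 4-PI operator $\Pi\left[\begin{smallmatrix}P&Q_1\\Q_2&\{R_0,R_1,R_2\}\end{smallmatrix}\right]$ maps $(x,f)\in\mathbb RL_2$ to $$\Big(Px+\int_a^bQ_1(\theta)f(\theta)d\theta,\ \ Q_2(s)x+R_0(s)f(s)+\int_a^sR_1(s,\theta)f(\theta)d\theta+\int_s^bR_2(s,\theta)f(\theta)d\theta\Big);$$ write $\{R_i\}$ for $\{R_0,R_1,R_2\}$. Let $$\Xi=\Pi\begin{bmatrix}[\,0\ \ D_{rb}\,]&C_r\\ [\,B_{xv}\ \ B_{xb}\,]&\{A_0,A_1,A_2\}\end{bmatrix},\quad \Upsilon=\Pi\begin{bmatrix}\begin{bmatrix}I\\B_T^{-1}B_v\\T(b-a)B_T^{-1}B_v\end{bmatrix}&\begin{bmatrix}0\\B_Q(s)\\T(b-a)B_Q(s)+Q(b-s)\end{bmatrix}\\U_2T(s-a)B_T^{-1}B_v&\{U_1,\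 U_2T(s-a)B_Q(\theta)+U_2Q(s-\theta),\ U_2T(s-a)B_Q(\theta)\}\end{bmatrix},$$ and let $\left[\begin{smallmatrix}D_{rv}&C_{rx}\\ \hat B_{xv}&\{\hat A_0,\hat A_1,\hat A_2\}\end{smallmatrix}\right]$ be the parameters of the composition $\Xi\Upsilon$, which is again a 4-PI operator, given by the following explicit formulas. Writing $P,Q_1,Q_2,R_i$ for the parameters of $\Xi$ and $P',Q_1',Q_2',R_i'$ for those of $\Upsilon$, $$D_{rv}=PP'+\int_a^bQ_1Q_2'\,ds,\qquad C_{rx}(s)=PQ_1'(s)+Q_1(s)R_0'(s)+\int_s^bQ_1(\eta)R_1'(\eta,s)d\eta+\int_a^sQ_1(\eta)R_2'(\eta,s)d\eta,$$ $$\hat B_{xv}(s)=Q_2(s)P'+R_0(s)Q_2'(s)+\int_a^sR_1(s,\eta)Q_2'(\eta)d\eta+\int_s^bR_2(s,\eta)Q_2'(\eta)d\eta,\qquad \hat A_0=R_0R_0',$$ $$\hat A_1(s,\eta)=Q_2(s)Q_1'(\eta)+R_0(s)R_1'(s,\eta)+R_1(s,\eta)R_0'(\eta)+\int_a^\eta R_1(s,\theta)R_2'(\theta,\eta)d\theta+\int_\eta^sR_1(s,\theta)R_1'(\theta,\eta)d\theta+\int_s^bR_2(s,\theta)R_1'(\theta,\eta)d\theta,$$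 $$\hat A_2(s,\eta)=Q_2(s)Q_1'(\eta)+R_0(s)R_2'(s,\eta)+R_2(s,\eta)R_0'(\eta)+\int_a^sR_1(s,\theta)R_2'(\theta,\eta)d\theta+\int_s^\eta R_2(s,\theta)R_2'(\theta,\eta)d\theta+\int_\eta^bR_2(s,\theta)R_1'(\theta,\eta)d\theta .$$ The PIE associated with the GPDE has the operators $$\mathcal T=\Pi\begin{bmatrix}I&0\\G_vC_v&\{G_0,G_1,G_2\}\end{bmatrix},\quad \mathcal T_w=\Pi\begin{bmatrix}0&\\G_vD_{vw}&\end{bmatrix},\quad\mathcal T_u=\Pi\begin{bmatrix}0&\\G_vD_{vu}&\end{bmatrix},\quad \mathcal A=\Pi\begin{bmatrix}A+B_{xr}D_{rv}C_v&B_{xr}C_{rx}\\\hat B_{xv}C_v&\{\hat A_i\}\end{bmatrix},$$ $$\mathcal B_1=\Pi\begin{bmatrix}B_{xw}+B_{xr}D_{rv}D_{vw}&\\\hat B_{xv}D_{vw}&\end{bmatrix},\quad\mathcal B_2=\Pi\begin{bmatrix}B_{xu}+B_{xr}D_{rv}D_{vu}&\\\hat B_{xv}D_{vu}&\end{bmatrix},$$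 $$\mathcal C_1=\Pi\begin{bmatrix}C_z+D_{zr}D_{rv}C_v&D_{zr}C_{rx}\end{bmatrix},\quad \mathcal C_2=\Pi\begin{bmatrix}C_y+D_{yr}D_{rv}C_v&D_{yr}C_{rx}\end{bmatrix},$$ and the matrices $\mathcal D_{11}=D_{zw}+D_{zr}D_{rv}D_{vw}$, $\mathcal D_{12}=D_{zu}+D_{zr}D_{rv}D_{vu}$, $\mathcal D_{21}=D_{yw}+D_{yr}D_{rv}D_{vw}$, $\mathcal D_{22}=D_{yu}+D_{yr}D_{rv}D_{vu}$. For $w,u\in L_{2e}$ such that $(\mathcal T_ww)(\cdot,s)$ and $(\mathcal T_uu)(\cdot,s)$ are in $W_{1e}$ for all $s\in[a,b]$, $\{\underline x,z,y\}$ *satisfies the PIE* with initial condition $\underline x^0\in\mathbb RL_2^{n_x,n_{\hat x}}$ and input $\{w,u\}$ if $z,y\in L_{2e}$; $\underline x(t)\in\mathbb RL_2^{n_x,n_{\hat x}}$ for all $t\ge0$; $t\mapsto\mathcal T\underline x(t)\in\mathbb RL_2$ is locally absolutely continuous on $\mathbb R_+$ and differentiable almost everywhere; $\underline x(0)=\underline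 x^0$; and for almost all $t\ge0$ $$\partial_t(\mathcal T\underline x)+\partial_t(\mathcal T_ww)+\partial_t(\mathcal T_uu)=\mathcal A\underline x+\mathcal B_1w+\mathcal B_2u,\quad z=\mathcal C_1\underline x+\mathcal D_{11}w+\mathcal D_{12}u,\quad y=\mathcal C_2\underline x+\mathcal D_{21}w+\mathcal D_{22}u .$$ **Stability** (inputs $w=0$, $u=0$). The GPDE is *Lyapunov stable in the $\mathbb R\times W^n$ norm* if for every $\varepsilon>0$ there is $\delta>0$ such that for all $(x^0,\hat x^0)\in\mathcal X_{0,0}$ with $\|(x^0,\hat x^0)\|_{\mathbb R\times W^n}<\delta$, every solution with this initial condition has $\|(x(t),\hat x(t))\|_{\mathbb R\times W^n}<\varepsilon$ for all $t\ge0$. It is *asymptotically stable* if for every $(x^0,\hat x^0)\in\mathcal X_{0,0}$ and $\varepsilon>0$ there is $T_\varepsilon>0$ such that every solution with this initial condition has $\|(x(t),\hat x(t))\|_{\mathbb R\times W^n}<\varepsilon$ for all $t>T_\varepsilon$. The PIE is *Lyapunov stable*, respectively *asymptotically stable*, *in the $\mathbb RL_2$ norm* if the same holds with initial conditions $\underline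 x^0\in\mathbb RL_2^{n_x,n_{\hat x}}$, solutions $\underline x$ of the PIE and the norm $\|\cdot\|_{\mathbb RL_2}$. **Corollary 5.** Suppose that the GPDE is admissible. Then 1. the GPDE is Lyapunov stable in the $\mathbb R\times W^n$ norm if and only if the associated PIE is Lyapunov stable in the $\mathbb RL_2$ norm; 2. the GPDE is asymptotically stable in the $\mathbb R\times W^n$ norm if and only if the associated PIE is asymptotically stable in the $\mathbb RL_2$ norm. -/

import Mathlib

open MeasureTheory Set
open scoped Matrix

noncomputable section

namespace GPIE

/-! ## Index sets

`n i` is the number of states that are `i` times differentiable, `0 ≤ i ≤ N`.  Block vectors are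
indexed by (component, order of derivative) instead of by consecutive integers. -/

/-- Components of the distributed state: `⟨i, k⟩` is the `k`-th component of the block `x̂ᵢ`. -/
abbrev StateIdx {N : ℕ} (n : Fin (N + 1) → ℕ) : Type := Σ i : Fin (N + 1), Fin (n i)

/-- Index set of `ℱ x̂`: a component of the block `x̂ᵢ` and an order of derivative `j ≤ i`. -/
abbrev FIdx {N : ℕ} (n : Fin (N + 1) → ℕ) : Type := Σ c : StateIdx n, Fin (c.1.val + 1)

/-- Index set of `𝒞 x̂`: a component of the block `x̂ᵢ` and an order of derivative `j < i`;
it has `n_S` elements. -/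
abbrev CIdx {N : ℕ} (n : Fin (N + 1) → ℕ) : Type := Σ c : StateIdx n, Fin c.1.val

/-! ## The spaces `L₂` and `ℝL₂` -/

/-- `L₂[a,b]` with values in the Euclidean space `ℝ^ι`. -/
abbrev L2Space (a b : ℝ) (ι : Type) [Fintype ι] : Type :=
  Lp (EuclideanSpace ℝ ι) 2 (volume.restrict (Icc a b))

/-- `ℝL₂ = ℝ^m × L₂^p[a,b]` with its Hilbert norm `(|x₁|² + ‖x₂‖²)^{1/2}`. -/
abbrev RL2 (a b : ℝ) (m p : Type) [Fintype m] [Fintype p] : Type :=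
  WithLp 2 (EuclideanSpace ℝ m × L2Space a b p)

open Classical in
/-- The class in `L₂[a,b]` of a square integrable function (`0` if it is not square integrable). -/
def ofFun (a b : ℝ) {ι : Type} [Fintype ι] (f : ℝ → ι → ℝ) : L2Space a b ι :=
  if h : MemLp (fun s => (WithLp.toLp 2 (f s) : EuclideanSpace ℝ ι)) 2
      (volume.restrict (Icc a b)) then h.toLp _ else 0

/-- The element of `ℝL₂` with the given two parts. -/
def pairRL2 (a b : ℝ) {m p : Type} [Fintype m] [Fintype p] (x : m → ℝ) (f : L2Space a b p) :
    RL2 a b m p :=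
  WithLp.toLp 2 ((WithLp.toLp 2 x : EuclideanSpace ℝ m), f)

/-- A finite-dimensional signal value `w ∈ ℝ^m`, seen in `ℝL₂^{m,0}`. -/
def finRL2 (a b : ℝ) {m : Type} [Fintype m] (w : m → ℝ) : RL2 a b m (Fin 0) := pairRL2 a b w 0

/-- Entrywise integral over `[a,b]` of a matrix-valued function. -/
def matInt (a b : ℝ) {p q : Type} (M : ℝ → Matrix p q ℝ) : Matrix p q ℝ :=
  Matrix.of fun i j => ∫ s in a..b, M s i j

/-! ## 4-PI operators -/

/-- Parameters `[P, Q₁; Q₂, {R₀, R₁, R₂}]` of a 4-PI operator from `ℝ^k × L₂^q` to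
`ℝ^m × L₂^p`. -/
structure FourPI (m k p q : Type) where
  P : Matrix m k ℝ
  Q₁ : ℝ → Matrix m q ℝ
  Q₂ : ℝ → Matrix p k ℝ
  R₀ : ℝ → Matrix p q ℝ
  R₁ : ℝ → ℝ → Matrix p q ℝ
  R₂ : ℝ → ℝ → Matrix p q ℝ

namespace FourPI

variable {m k p q : Type} [Fintype m] [Fintype k] [Fintype p] [Fintype q]

/-- Finite-dimensional part of the image of `(u, f)`. -/
def fin (a b : ℝ) (K : FourPI m k p q) (u : k → ℝ) (f : ℝ → q → ℝ) : m → ℝ :=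
  K.P *ᵥ u + ∫ θ in a..b, K.Q₁ θ *ᵥ f θ

/-- Distributed part of the image of `(u, f)`, as a function of `s ∈ [a,b]`. -/
def fn (a b : ℝ) (K : FourPI m k p q) (u : k → ℝ) (f : ℝ → q → ℝ) (s : ℝ) : p → ℝ :=
  K.Q₂ s *ᵥ u + (K.R₀ s *ᵥ f s + (∫ θ in a..s, K.R₁ s θ *ᵥ f θ) + ∫ θ in s..b, K.R₂ s θ *ᵥ f θ)

/-- The 4-PI operator on `ℝL₂`. -/
def apply (a b : ℝ) (K : FourPI m k p q) (x : RL2 a b k q) : RL2 a b m p :=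
  pairRL2 a b (K.fin a b x.fst.ofLp fun s => (x.snd s).ofLp)
    (ofFun a b (K.fn a b x.fst.ofLp fun s => (x.snd s).ofLp))

/-- The parameter map `P⁴_×` of the composition of two 4-PI operators. -/
def comp {m k l p q r : Type} [Fintype k] [Fintype q] (a b : ℝ)
    (K : FourPI m k p q) (L : FourPI k l q r) : FourPI m l p r where
  P := K.P * L.P + matInt a b fun s => K.Q₁ s * L.Q₂ s
  Q₁ s := K.P * L.Q₁ s + K.Q₁ s * L.R₀ s + (matInt s b fun η => K.Q₁ η * L.R₁ η s)
    + matInt a s fun η => K.Q₁ η * L.R₂ η s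
  Q₂ s := K.Q₂ s * L.P + K.R₀ s * L.Q₂ s + (matInt a s fun η => K.R₁ s η * L.Q₂ η)
    + matInt s b fun η => K.R₂ s η * L.Q₂ η
  R₀ s := K.R₀ s * L.R₀ s
  R₁ s η := K.Q₂ s * L.Q₁ η + K.R₀ s * L.R₁ s η + K.R₁ s η * L.R₀ η
    + (matInt a η fun θ => K.R₁ s θ * L.R₂ θ η) + (matInt η s fun θ => K.R₁ s θ * L.R₁ θ η)
    + matInt s b fun θ => K.R₂ s θ * L.R₁ θ η
  R₂ s η := K.Q₂ s * L.Q₁ η + K.R₀ s * L.R₂ s η + K.R₂ s η * L.R₀ η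
    + (matInt a s fun θ => K.R₁ s θ * L.R₂ θ η) + (matInt s η fun θ => K.R₂ s θ * L.R₂ θ η)
    + matInt η b fun θ => K.R₂ s θ * L.R₁ θ η

end FourPI

/-! ## Signals in time -/

/-- `f ∈ L_{2e}[ℝ₊]`. -/
def MemL2e {E : Type} [NormedAddCommGroup E] (f : ℝ → E) : Prop :=
  ∀ τ : ℝ, 0 ≤ τ → MemLp f 2 (volume.restrict (Icc 0 τ))

/-- `f` is absolutely continuous on every bounded interval `[0, τ]`. -/
def LocAC {E : Type} [PseudoMetricSpace E] (f : ℝ → E) : Prop :=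
  ∀ τ : ℝ, 0 ≤ τ → AbsolutelyContinuousOnInterval f 0 τ

/-- `f ∈ W_{1e}[ℝ₊]`, for `f` with values in a finite-dimensional space. -/
def MemW1e {E : Type} [NormedAddCommGroup E] [NormedSpace ℝ E] (f : ℝ → E) : Prop :=
  LocAC f ∧ MemL2e f ∧ MemL2e (deriv f)

/-! ## The distributed state and the Sobolev space `Wⁿ` -/

/-- `u ∈ W_k[a,b]`: the derivatives of order less than `k` are absolutely continuous and all
derivatives up to order `k` are square integrable on `[a,b]`. -/
def MemW (a b : ℝ) (k : ℕ) (u : ℝ → ℝ) : Prop :=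
  (∀ j < k, AbsolutelyContinuousOnInterval (iteratedDerivWithin j u (Icc a b)) a b) ∧
  ∀ j ≤ k, MemLp (iteratedDerivWithin j u (Icc a b)) 2 (volume.restrict (Icc a b))

section State

variable {N : ℕ} {n : Fin (N + 1) → ℕ}

/-- `x̂ ∈ Wⁿ[a,b]`. -/
def MemWn (a b : ℝ) (x : ℝ → StateIdx n → ℝ) : Prop :=
  ∀ c : StateIdx n, MemW a b c.1.val fun s => x s c

/-- `ℱ x̂`: all partial derivatives of the state that the continuity constraint permits. -/
def allDerivs (a b : ℝ) (x : ℝ → StateIdx n → ℝ) (s : ℝ) : FIdx n → ℝ :=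
  fun p => iteratedDerivWithin p.2.val (fun σ => x σ p.1) (Icc a b) s

/-- `𝒞 x̂`: all absolutely continuous functions among these. -/
def contDerivs (a b : ℝ) (x : ℝ → StateIdx n → ℝ) (s : ℝ) : CIdx n → ℝ :=
  fun p => iteratedDerivWithin p.2.val (fun σ => x σ p.1) (Icc a b) s

/-- `ℬ x̂`: the boundary values of `𝒞 x̂` at `a` and at `b`. -/
def bdryValues (a b : ℝ) (x : ℝ → StateIdx n → ℝ) : CIdx n ⊕ CIdx n → ℝ :=
  Sum.elim (contDerivs a b x a) (contDerivs a b x b)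

/-- The norm of `ℝ^{n_x} × Wⁿ`: `|x| + ∑ᵢ ∑_{j ≤ i} ‖∂ₛʲ x̂ᵢ‖_{L₂^{nᵢ}}`. -/
def wNorm (a b : ℝ) {nx : ℕ} (x : Fin nx → ℝ) (xh : ℝ → StateIdx n → ℝ) : ℝ :=
  ‖(WithLp.toLp 2 x : EuclideanSpace ℝ (Fin nx))‖ +
    ∑ i : Fin (N + 1), ∑ j ∈ Finset.range (i.val + 1),
      Real.sqrt (∑ l : Fin (n i), ∫ s in a..b,
        (iteratedDerivWithin j (fun σ => xh σ ⟨i, l⟩) (Icc a b) s) ^ 2)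

end State

/-! ## Parameters of a GPDE -/

/-- `G_o`: parameters of the ODE subsystem. -/
structure ODEParams (nx nw nu nr nz ny nv : ℕ) where
  A : Matrix (Fin nx) (Fin nx) ℝ
  Bxw : Matrix (Fin nx) (Fin nw) ℝ
  Bxu : Matrix (Fin nx) (Fin nu) ℝ
  Bxr : Matrix (Fin nx) (Fin nr) ℝ
  Cz : Matrix (Fin nz) (Fin nx) ℝ
  Dzw : Matrix (Fin nz) (Fin nw) ℝ
  Dzu : Matrix (Fin nz) (Fin nu) ℝ
  Dzr : Matrix (Fin nz) (Fin nr) ℝ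
  Cy : Matrix (Fin ny) (Fin nx) ℝ
  Dyw : Matrix (Fin ny) (Fin nw) ℝ
  Dyu : Matrix (Fin ny) (Fin nu) ℝ
  Dyr : Matrix (Fin ny) (Fin nr) ℝ
  Cv : Matrix (Fin nv) (Fin nx) ℝ
  Dvw : Matrix (Fin nv) (Fin nw) ℝ
  Dvu : Matrix (Fin nv) (Fin nu) ℝ

/-- `G_b`: parameters of the boundary conditions. -/
structure BCParams {N : ℕ} (n : Fin (N + 1) → ℕ) (nBC nv : ℕ) where
  B : Matrix (Fin nBC) (CIdx n ⊕ CIdx n) ℝ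
  BI : ℝ → Matrix (Fin nBC) (FIdx n) ℝ
  Bv : Matrix (Fin nBC) (Fin nv) ℝ

/-- `G_p`: parameters of the in-domain dynamics and of the output of the PDE subsystem. -/
structure PDEParams {N : ℕ} (n : Fin (N + 1) → ℕ) (nv nr : ℕ) where
  A₀ : ℝ → Matrix (StateIdx n) (FIdx n) ℝ
  A₁ : ℝ → ℝ → Matrix (StateIdx n) (FIdx n) ℝ
  A₂ : ℝ → ℝ → Matrix (StateIdx n) (FIdx n) ℝ
  Bxv : ℝ → Matrix (StateIdx n) (Fin nv) ℝ
  Bxb : ℝ → Matrix (StateIdx n) (CIdx n ⊕ CIdx n) ℝ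
  Cr : ℝ → Matrix (Fin nr) (FIdx n) ℝ
  Drb : Matrix (Fin nr) (CIdx n ⊕ CIdx n) ℝ

/-- `B_I` is square integrable on `[a,b]`. -/
def BCParams.Regular {N : ℕ} {n : Fin (N + 1) → ℕ} {nBC nv : ℕ} (a b : ℝ)
    (Gb : BCParams n nBC nv) : Prop :=
  ∀ i j, MemLp (fun s => Gb.BI s i j) 2 (volume.restrict (Icc a b))

/-- The functional parameters of `G_p` are measurable and essentially bounded on `[a,b]`,
respectively on `[a,b]²`. -/
def PDEParams.Regular {N : ℕ} {n : Fin (N + 1) → ℕ} {nv nr : ℕ} (a b : ℝ)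
    (Gp : PDEParams n nv nr) : Prop :=
  (∀ i j, MemLp (fun s => Gp.A₀ s i j) ⊤ (volume.restrict (Icc a b))) ∧
  (∀ i j, MemLp (fun s : ℝ × ℝ => Gp.A₁ s.1 s.2 i j) ⊤
    ((volume.restrict (Icc a b)).prod (volume.restrict (Icc a b)))) ∧
  (∀ i j, MemLp (fun s : ℝ × ℝ => Gp.A₂ s.1 s.2 i j) ⊤
    ((volume.restrict (Icc a b)).prod (volume.restrict (Icc a b)))) ∧
  (∀ i j, MemLp (fun s => Gp.Bxv s i j) ⊤ (volume.restrict (Icc a b))) ∧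
  (∀ i j, MemLp (fun s => Gp.Bxb s i j) ⊤ (volume.restrict (Icc a b))) ∧
  ∀ i j, MemLp (fun s => Gp.Cr s i j) ⊤ (volume.restrict (Icc a b))

/-! ## Admissibility -/

section Blocks

variable {N : ℕ} (n : Fin (N + 1) → ℕ)

/-- `τ_j(s) = s^j / j!`. -/
def tau (j : ℕ) (s : ℝ) : ℝ := s ^ j / (j.factorial : ℝ)

/-- `T(s)`: the entry at the derivatives of orders `j ≤ j'` of one and the same component is
`τ_{j'-j}(s)`; all other entries vanish. -/
def Tmat (s : ℝ) : Matrix (CIdx n) (CIdx n) ℝ :=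
  Matrix.of fun p p' =>
    if p.1 = p'.1 ∧ p.2.val ≤ p'.2.val then tau (p'.2.val - p.2.val) s else 0

/-- `Q(s)`: the entry at the derivative of order `j` of a component of the block `x̂ᵢ`
(`j < i`) and at that component is `τ_{i-j-1}(s)`; all other entries vanish. -/
def Qmat (s : ℝ) : Matrix (CIdx n) (StateIdx n) ℝ :=
  Matrix.of fun p c => if p.1 = c then tau (c.1.val - p.2.val - 1) s else 0

/-- `U₁` places the highest derivatives `∂ₛⁱ x̂ᵢ` into `ℱ x̂`. -/
def U1mat : Matrix (FIdx n) (StateIdx n) ℝ :=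
  Matrix.of fun p c => if p.1 = c ∧ p.2.val = c.1.val then 1 else 0

/-- `U₂` places `𝒞 x̂` into `ℱ x̂`. -/
def U2mat : Matrix (FIdx n) (CIdx n) ℝ :=
  Matrix.of fun p p' => if p.1 = p'.1 ∧ p.2.val = p'.2.val then 1 else 0

/-- `[0; M₁]`, where `M₁` is the first block row (derivatives of order zero of the blocks
`x̂₁, …, x̂_N`) of `M`, and the zero rows stand for the block `x̂₀`. -/
def firstRows {κ : Type} (M : Matrix (CIdx n) κ ℝ) : Matrix (StateIdx n) κ ℝ :=
  Matrix.of fun c k => if h : 0 < c.1.val then M ⟨c, ⟨0, h⟩⟩ k else 0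

end Blocks

section BC

variable {N : ℕ} {n : Fin (N + 1) → ℕ} {nBC nv : ℕ}

/-- `B_T = B [T(0); T(b-a)] - ∫ₐᵇ B_I(s) U₂ T(s-a) ds`. -/
def BT (a b : ℝ) (Gb : BCParams n nBC nv) : Matrix (Fin nBC) (CIdx n) ℝ :=
  Gb.B * Matrix.fromRows (Tmat n 0) (Tmat n (b - a))
    - matInt a b fun s => Gb.BI s * U2mat n * Tmat n (s - a)

/-- The pair `{n, G_b}` is admissible: `B_T` is invertible (in particular square). -/
def Admissible (a b : ℝ) (Gb : BCParams n nBC nv) : Prop :=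
  ∃ M : Matrix (CIdx n) (Fin nBC) ℝ, M * BT a b Gb = 1 ∧ BT a b Gb * M = 1

open Classical in
/-- `B_T⁻¹` (`0` if `B_T` is not invertible). -/
def BTinv (a b : ℝ) (Gb : BCParams n nBC nv) : Matrix (CIdx n) (Fin nBC) ℝ :=
  if h : Admissible a b Gb then h.choose else 0

/-- `B_Q(s) = B_T⁻¹ (B_I(s) U₁ + ∫ₛᵇ B_I(θ) U₂ Q(θ-s) dθ - B [0; Q(b-s)])`. -/
def BQ (a b : ℝ) (Gb : BCParams n nBC nv) (s : ℝ) : Matrix (CIdx n) (StateIdx n) ℝ :=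
  BTinv a b Gb * (Gb.BI s * U1mat n + (matInt s b fun θ => Gb.BI θ * U2mat n * Qmat n (θ - s))
    - Gb.B * Matrix.fromRows (0 : Matrix (CIdx n) (StateIdx n) ℝ) (Qmat n (b - s)))

/-- `G₀`. -/
def G0 (n : Fin (N + 1) → ℕ) : Matrix (StateIdx n) (StateIdx n) ℝ :=
  Matrix.diagonal fun c => if c.1.val = 0 then 1 else 0

/-- `G₂(s,θ) = [0; T₁(s-a) B_Q(θ)]`. -/
def G2 (a b : ℝ) (Gb : BCParams n nBC nv) (s θ : ℝ) : Matrix (StateIdx n) (StateIdx n) ℝ :=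
  firstRows n (Tmat n (s - a) * BQ a b Gb θ)

/-- `G₁(s,θ) = [0; Q₁(s-θ)] + G₂(s,θ)`. -/
def G1 (a b : ℝ) (Gb : BCParams n nBC nv) (s θ : ℝ) : Matrix (StateIdx n) (StateIdx n) ℝ :=
  firstRows n (Qmat n (s - θ)) + G2 a b Gb s θ

/-- `G_v(s) = [0; T₁(s-a) B_T⁻¹ B_v]`. -/
def Gv (a b : ℝ) (Gb : BCParams n nBC nv) (s : ℝ) : Matrix (StateIdx n) (Fin nv) ℝ :=
  firstRows n (Tmat n (s - a) * BTinv a b Gb * Gb.Bv)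

/-! ## State spaces `X_v` and `𝒳_{w,u}` -/

/-- `X_v`: the states in `Wⁿ[a,b]` that satisfy the boundary conditions with input value `v`. -/
def Xset (a b : ℝ) (Gb : BCParams n nBC nv) (v : Fin nv → ℝ) : Set (ℝ → StateIdx n → ℝ) :=
  {x | MemWn a b x ∧
    (∫ s in a..b, Gb.BI s *ᵥ allDerivs a b x s) + (Gb.Bv *ᵥ v - Gb.B *ᵥ bdryValues a b x) = 0}

/-- `𝒳_{w,u}`. -/
def XXset {nx nw nu nr nz ny : ℕ} (a b : ℝ) (Go : ODEParams nx nw nu nr nz ny nv)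
    (Gb : BCParams n nBC nv) (w : Fin nw → ℝ) (u : Fin nu → ℝ) :
    Set ((Fin nx → ℝ) × (ℝ → StateIdx n → ℝ)) :=
  {x | x.2 ∈ Xset a b Gb (Go.Cv *ᵥ x.1 + Go.Dvw *ᵥ w + Go.Dvu *ᵥ u)}

end BC

/-! ## Solutions and stability of a GPDE -/

section GPDE

variable {N : ℕ} {n : Fin (N + 1) → ℕ} {nx nw nu nr nz ny nv nBC : ℕ}

/-- Right-hand side of the in-domain dynamics at `s ∈ [a,b]`. -/
def pdeRHS (a b : ℝ) (Gp : PDEParams n nv nr) (v : Fin nv → ℝ) (x : ℝ → StateIdx n → ℝ)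
    (s : ℝ) : StateIdx n → ℝ :=
  Gp.A₀ s *ᵥ allDerivs a b x s + (Gp.Bxv s *ᵥ v + Gp.Bxb s *ᵥ bdryValues a b x)
    + ((∫ θ in a..s, Gp.A₁ s θ *ᵥ allDerivs a b x θ)
      + ∫ θ in s..b, Gp.A₂ s θ *ᵥ allDerivs a b x θ)

/-- Output of the PDE subsystem. -/
def pdeOutput (a b : ℝ) (Gp : PDEParams n nv nr) (x : ℝ → StateIdx n → ℝ) : Fin nr → ℝ :=
  Gp.Drb *ᵥ bdryValues a b x + ∫ θ in a..b, Gp.Cr θ *ᵥ allDerivs a b x θ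

/-- `{x, x̂, z, y, v, r}` satisfies the GPDE with initial condition `{x⁰, x̂⁰}` and input `{w, u}`.
The distributed state `x̂(t)` is a function on `[a,b]`; differentiability of `t ↦ x̂(t)` is with
respect to the norm of `L₂[a,b]`. -/
structure GPDESolution (a b : ℝ) (Go : ODEParams nx nw nu nr nz ny nv) (Gb : BCParams n nBC nv)
    (Gp : PDEParams n nv nr) (x0 : Fin nx → ℝ) (xh0 : ℝ → StateIdx n → ℝ)
    (w : ℝ → Fin nw → ℝ) (u : ℝ → Fin nu → ℝ)
    (x : ℝ → Fin nx → ℝ) (xh : ℝ → ℝ → StateIdx n → ℝ) (z : ℝ → Fin nz → ℝ)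
    (y : ℝ → Fin ny → ℝ) (v : ℝ → Fin nv → ℝ) (r : ℝ → Fin nr → ℝ) : Prop where
  memL2e_w : MemL2e w
  memL2e_u : MemL2e u
  memW1e_w : MemW1e fun t => Gb.Bv *ᵥ (Go.Dvw *ᵥ w t)
  memW1e_u : MemW1e fun t => Gb.Bv *ᵥ (Go.Dvu *ᵥ u t)
  memL2e_z : MemL2e z
  memL2e_y : MemL2e y
  memL2e_v : MemL2e v
  mem_domain : ∀ t, 0 ≤ t → (x t, xh t) ∈ XXset a b Go Gb (w t) (u t)
  locAC_x : LocAC x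
  locAC_xh : LocAC fun t => ofFun a b (xh t)
  init_x : x 0 = x0
  init_xh : xh 0 = xh0
  ode : ∀ᵐ t ∂volume.restrict (Ici (0 : ℝ)),
    HasDerivAt x (Go.A *ᵥ x t + Go.Bxw *ᵥ w t + Go.Bxu *ᵥ u t + Go.Bxr *ᵥ r t) t ∧
    z t = Go.Cz *ᵥ x t + Go.Dzw *ᵥ w t + Go.Dzu *ᵥ u t + Go.Dzr *ᵥ r t ∧
    y t = Go.Cy *ᵥ x t + Go.Dyw *ᵥ w t + Go.Dyu *ᵥ u t + Go.Dyr *ᵥ r t ∧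
    v t = Go.Cv *ᵥ x t + Go.Dvw *ᵥ w t + Go.Dvu *ᵥ u t
  pde : ∀ᵐ t ∂volume.restrict (Ici (0 : ℝ)),
    HasDerivAt (fun t' => ofFun a b (xh t')) (ofFun a b (pdeRHS a b Gp (v t) (xh t))) t ∧
    r t = pdeOutput a b Gp (xh t)

/-- Lyapunov stability of the GPDE in the `ℝ^{n_x} × Wⁿ` norm. -/
def GPDELyapunovStable (a b : ℝ) (Go : ODEParams nx nw nu nr nz ny nv) (Gb : BCParams n nBC nv)
    (Gp : PDEParams n nv nr) : Prop :=
  ∀ ε : ℝ, 0 < ε → ∃ δ : ℝ, 0 < δ ∧ ∀ x0 xh0, (x0, xh0) ∈ XXset a b Go Gb 0 0 →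
    wNorm a b x0 xh0 < δ → ∀ x xh z y v r,
      GPDESolution a b Go Gb Gp x0 xh0 (fun _ => 0) (fun _ => 0) x xh z y v r →
        ∀ t : ℝ, 0 ≤ t → wNorm a b (x t) (xh t) < ε

/-- Asymptotic stability of the GPDE in the `ℝ^{n_x} × Wⁿ` norm. -/
def GPDEAsymptoticallyStable (a b : ℝ) (Go : ODEParams nx nw nu nr nz ny nv)
    (Gb : BCParams n nBC nv) (Gp : PDEParams n nv nr) : Prop :=
  ∀ x0 xh0, (x0, xh0) ∈ XXset a b Go Gb 0 0 → ∀ ε : ℝ, 0 < ε → ∃ Tε : ℝ, 0 < Tε ∧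
    ∀ x xh z y v r,
      GPDESolution a b Go Gb Gp x0 xh0 (fun _ => 0) (fun _ => 0) x xh z y v r →
        ∀ t : ℝ, Tε < t → wNorm a b (x t) (xh t) < ε

end GPDE

/-! ## Solutions and stability of a PIE -/

/-- `G_PIE`: the twelve 4-PI parameters of a PIE with state in `ℝL₂^{n_x, p}`. -/
structure PIEParams (nx nw nu nz ny : ℕ) (p : Type) where
  T : FourPI (Fin nx) (Fin nx) p p
  Tw : FourPI (Fin nx) (Fin nw) p (Fin 0)
  Tu : FourPI (Fin nx) (Fin nu) p (Fin 0)
  A : FourPI (Fin nx) (Fin nx) p p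
  B₁ : FourPI (Fin nx) (Fin nw) p (Fin 0)
  B₂ : FourPI (Fin nx) (Fin nu) p (Fin 0)
  C₁ : FourPI (Fin nz) (Fin nx) (Fin 0) p
  C₂ : FourPI (Fin ny) (Fin nx) (Fin 0) p
  D₁₁ : FourPI (Fin nz) (Fin nw) (Fin 0) (Fin 0)
  D₁₂ : FourPI (Fin nz) (Fin nu) (Fin 0) (Fin 0)
  D₂₁ : FourPI (Fin ny) (Fin nw) (Fin 0) (Fin 0)
  D₂₂ : FourPI (Fin ny) (Fin nu) (Fin 0) (Fin 0)

section PIE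

variable {nx nw nu nz ny : ℕ} {p : Type} [Fintype p]

/-- For all `s ∈ [a,b]`, the value at `s` of the image of the signal `w` is in `W_{1e}[ℝ₊]`. -/
def ImageMemW1e (a b : ℝ) {k : ℕ} (K : FourPI (Fin nx) (Fin k) p (Fin 0))
    (w : ℝ → Fin k → ℝ) : Prop :=
  ∀ s ∈ Icc a b, MemW1e (fun t => K.fin a b (w t) 0) ∧ MemW1e (fun t => K.fn a b (w t) 0 s)

/-- `{x, z, y}` satisfies the PIE with initial condition `x⁰` and input `{w, u}`.
Differentiability of `t ↦ x(t)` is with respect to the norm `‖𝒯 x‖` of `ℝL₂`, that is,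
it is differentiability of `t ↦ 𝒯 x(t)` in `ℝL₂`. -/
structure PIESolution (a b : ℝ) (G : PIEParams nx nw nu nz ny p) (x0 : RL2 a b (Fin nx) p)
    (w : ℝ → Fin nw → ℝ) (u : ℝ → Fin nu → ℝ)
    (x : ℝ → RL2 a b (Fin nx) p) (z : ℝ → Fin nz → ℝ) (y : ℝ → Fin ny → ℝ) : Prop where
  memL2e_w : MemL2e w
  memL2e_u : MemL2e u
  memW1e_w : ImageMemW1e a b G.Tw w
  memW1e_u : ImageMemW1e a b G.Tu u
  memL2e_z : MemL2e z
  memL2e_y : MemL2e y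
  locAC_Tx : LocAC fun t => G.T.apply a b (x t)
  init : x 0 = x0
  pie : ∀ᵐ t ∂volume.restrict (Ici (0 : ℝ)), ∃ dTx dTw dTu : RL2 a b (Fin nx) p,
    HasDerivAt (fun t' => G.T.apply a b (x t')) dTx t ∧
    HasDerivAt (fun t' => G.Tw.apply a b (finRL2 a b (w t'))) dTw t ∧
    HasDerivAt (fun t' => G.Tu.apply a b (finRL2 a b (u t'))) dTu t ∧
    dTx = G.A.apply a b (x t) + G.B₁.apply a b (finRL2 a b (w t))
      + G.B₂.apply a b (finRL2 a b (u t)) - (dTw + dTu) ∧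
    finRL2 a b (z t) = G.C₁.apply a b (x t) + G.D₁₁.apply a b (finRL2 a b (w t))
      + G.D₁₂.apply a b (finRL2 a b (u t)) ∧
    finRL2 a b (y t) = G.C₂.apply a b (x t) + G.D₂₁.apply a b (finRL2 a b (w t))
      + G.D₂₂.apply a b (finRL2 a b (u t))

/-- Lyapunov stability of the PIE in the `ℝL₂` norm. -/
def PIELyapunovStable (a b : ℝ) (G : PIEParams nx nw nu nz ny p) : Prop :=
  ∀ ε : ℝ, 0 < ε → ∃ δ : ℝ, 0 < δ ∧ ∀ x0 : RL2 a b (Fin nx) p, ‖x0‖ < δ → ∀ x z y,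
    PIESolution a b G x0 (fun _ => 0) (fun _ => 0) x z y → ∀ t : ℝ, 0 ≤ t → ‖x t‖ < ε

/-- Asymptotic stability of the PIE in the `ℝL₂` norm. -/
def PIEAsymptoticallyStable (a b : ℝ) (G : PIEParams nx nw nu nz ny p) : Prop :=
  ∀ (x0 : RL2 a b (Fin nx) p) (ε : ℝ), 0 < ε → ∃ Tε : ℝ, 0 < Tε ∧ ∀ x z y,
    PIESolution a b G x0 (fun _ => 0) (fun _ => 0) x z y → ∀ t : ℝ, Tε < t → ‖x t‖ < ε

end PIE

/-! ## The PIE associated with a GPDE -/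

section Map

variable {N : ℕ} {n : Fin (N + 1) → ℕ} {nx nw nu nr nz ny nv nBC : ℕ}

/-- `Υ`, which maps `(v, 𝒟 x̂)` to `((v, ℬ x̂), ℱ x̂)`. -/
def Upsilon (a b : ℝ) (Gb : BCParams n nBC nv) :
    FourPI (Fin nv ⊕ (CIdx n ⊕ CIdx n)) (Fin nv) (FIdx n) (StateIdx n) where
  P := Matrix.fromRows 1 (Matrix.fromRows (BTinv a b Gb * Gb.Bv)
    (Tmat n (b - a) * BTinv a b Gb * Gb.Bv))
  Q₁ s := Matrix.fromRows 0 (Matrix.fromRows (BQ a b Gb s)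
    (Tmat n (b - a) * BQ a b Gb s + Qmat n (b - s)))
  Q₂ s := U2mat n * Tmat n (s - a) * BTinv a b Gb * Gb.Bv
  R₀ _ := U1mat n
  R₁ s θ := U2mat n * Tmat n (s - a) * BQ a b Gb θ + U2mat n * Qmat n (s - θ)
  R₂ s θ := U2mat n * Tmat n (s - a) * BQ a b Gb θ

/-- `Ξ`, which maps `((v, ℬ x̂), ℱ x̂)` to the output `r` and the right-hand side of the PDE. -/
def Xi (Gp : PDEParams n nv nr) :
    FourPI (Fin nr) (Fin nv ⊕ (CIdx n ⊕ CIdx n)) (StateIdx n) (FIdx n) where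
  P := Matrix.fromCols 0 Gp.Drb
  Q₁ s := Gp.Cr s
  Q₂ s := Matrix.fromCols (Gp.Bxv s) (Gp.Bxb s)
  R₀ s := Gp.A₀ s
  R₁ s θ := Gp.A₁ s θ
  R₂ s θ := Gp.A₂ s θ

/-- `[D_rv, C_rx; B_xv, {Âᵢ}] = P⁴_×(Ξ, Υ)`, the parameters of the PIE form of the PDE
subsystem. -/
def subPIE (a b : ℝ) (Gb : BCParams n nBC nv) (Gp : PDEParams n nv nr) :
    FourPI (Fin nr) (Fin nv) (StateIdx n) (StateIdx n) :=
  (Xi Gp).comp a b (Upsilon a b Gb)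

/-- `M(n, G_b, G_o, G_p)`: the PIE associated with a GPDE. -/
def assocPIE (a b : ℝ) (Go : ODEParams nx nw nu nr nz ny nv) (Gb : BCParams n nBC nv)
    (Gp : PDEParams n nv nr) : PIEParams nx nw nu nz ny (StateIdx n) where
  T := { P := 1, Q₁ := 0, Q₂ := fun s => Gv a b Gb s * Go.Cv, R₀ := fun _ => G0 n,
         R₁ := G1 a b Gb, R₂ := G2 a b Gb }
  Tw := { P := 0, Q₁ := 0, Q₂ := fun s => Gv a b Gb s * Go.Dvw, R₀ := 0, R₁ := 0, R₂ := 0 }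
  Tu := { P := 0, Q₁ := 0, Q₂ := fun s => Gv a b Gb s * Go.Dvu, R₀ := 0, R₁ := 0, R₂ := 0 }
  A := { P := Go.A + Go.Bxr * (subPIE a b Gb Gp).P * Go.Cv
         Q₁ := fun s => Go.Bxr * (subPIE a b Gb Gp).Q₁ s
         Q₂ := fun s => (subPIE a b Gb Gp).Q₂ s * Go.Cv
         R₀ := (subPIE a b Gb Gp).R₀
         R₁ := (subPIE a b Gb Gp).R₁
         R₂ := (subPIE a b Gb Gp).R₂ }
  B₁ := { P := Go.Bxw + Go.Bxr * (subPIE a b Gb Gp).P * Go.Dvw, Q₁ := 0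
          Q₂ := fun s => (subPIE a b Gb Gp).Q₂ s * Go.Dvw, R₀ := 0, R₁ := 0, R₂ := 0 }
  B₂ := { P := Go.Bxu + Go.Bxr * (subPIE a b Gb Gp).P * Go.Dvu, Q₁ := 0
          Q₂ := fun s => (subPIE a b Gb Gp).Q₂ s * Go.Dvu, R₀ := 0, R₁ := 0, R₂ := 0 }
  C₁ := { P := Go.Cz + Go.Dzr * (subPIE a b Gb Gp).P * Go.Cv
          Q₁ := fun s => Go.Dzr * (subPIE a b Gb Gp).Q₁ s
          Q₂ := 0, R₀ := 0, R₁ := 0, R₂ := 0 }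
  C₂ := { P := Go.Cy + Go.Dyr * (subPIE a b Gb Gp).P * Go.Cv
          Q₁ := fun s => Go.Dyr * (subPIE a b Gb Gp).Q₁ s
          Q₂ := 0, R₀ := 0, R₁ := 0, R₂ := 0 }
  D₁₁ := { P := Go.Dzw + Go.Dzr * (subPIE a b Gb Gp).P * Go.Dvw
           Q₁ := 0, Q₂ := 0, R₀ := 0, R₁ := 0, R₂ := 0 }
  D₁₂ := { P := Go.Dzu + Go.Dzr * (subPIE a b Gb Gp).P * Go.Dvu
           Q₁ := 0, Q₂ := 0, R₀ := 0, R₁ := 0, R₂ := 0 }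
  D₂₁ := { P := Go.Dyw + Go.Dyr * (subPIE a b Gb Gp).P * Go.Dvw
           Q₁ := 0, Q₂ := 0, R₀ := 0, R₁ := 0, R₂ := 0 }
  D₂₂ := { P := Go.Dyu + Go.Dyr * (subPIE a b Gb Gp).P * Go.Dvu
           Q₁ := 0, Q₂ := 0, R₀ := 0, R₁ := 0, R₂ := 0 }

end Map

end GPIE

end

noncomputable section

set_option linter.unusedSectionVars false

namespace GPIE

/-! For zero inputs, `(x, x̂) ↦ X = (x, 𝒟 x̂)` identifies the admissible states of the GPDE, up to
null sets in the block `x̂₀`, with all of `ℝL₂`. Taylor's formula expresses `𝒞 x̂` through `(𝒞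
x̂)(a)` and `𝒟 x̂` (`contDerivs_eq`). Inserted into the boundary conditions it gives a linear system
for `(𝒞 x̂)(a)` with matrix `B_T`, which admissibility makes uniquely solvable (`mem_Xset_iff`).
Conversely, iterated primitives of any square integrable function, started from that solution, form
a state that satisfies the boundary conditions (`corresponds_toState`).

Under this identification `𝒯 X = (x, x̂)` (`Corresponds.T_apply`), and `Υ` recovers `v`, `ℬ x̂` and
`ℱ x̂` from `v` and `𝒟 x̂`. Since `Ξ` computes `r` and the right-hand side of the PDE from these,
`ΞΥ` computes them from `v` and `𝒟 x̂`. The parameter formulas of the composition are Fubini's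
theorem for kernels that jump across the diagonal (`FourPI.fin_comp`, `FourPI.fn_comp`). Hence the
two evolution equations are the same equation in different coordinates, with the same `z` and `y`
(`pieSolution_of_gpdeSolution`, `gpdeSolution_of_pieSolution`).

The coordinates are comparable in norm: `‖X‖` is at most the `ℝ × Wⁿ` norm because `𝒟 x̂` is among
the derivatives counted there (`Corresponds.norm_le`), and the `ℝ × Wⁿ` norm is at most `C ‖X‖`
because the boundary conditions and Taylor's formula control the lower derivatives
(`exists_wNorm_le`). As `C` depends neither on the state nor on time, both notions of stability
carry over in both directions. -/

/-- Lebesgue measure on `[a,b]`. -/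
abbrev leb (a b : ℝ) : Measure ℝ := volume.restrict (Icc a b)

/-! ### Integrals of vector-valued functions over subintervals of `[a,b]` -/

section Integrals

variable {a b s t : ℝ} {m p q : Type} {E : Type} [NormedAddCommGroup E]

lemma intervalIntegrable_of_mem {g : ℝ → E} (h : Integrable g (leb a b)) (hs : s ∈ Icc a b)
    (ht : t ∈ Icc a b) : IntervalIntegrable g volume s t :=
  IntegrableOn.intervalIntegrable (IntegrableOn.mono_set h (uIcc_subset_Icc hs ht))

variable [NormedSpace ℝ E]

lemma intervalIntegral_eq_leb (hab : a ≤ b) (g : ℝ → E) :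
    ∫ s in a..b, g s = ∫ s, g s ∂leb a b := by
  rw [intervalIntegral.integral_of_le hab, integral_Icc_eq_integral_Ioc]

lemma intervalIntegral_congr_leb {g₁ g₂ : ℝ → E} (h : g₁ =ᵐ[leb a b] g₂) (hs : s ∈ Icc a b)
    (ht : t ∈ Icc a b) : ∫ θ in s..t, g₁ θ = ∫ θ in s..t, g₂ θ := by
  apply intervalIntegral.integral_congr_ae
  have := (ae_restrict_iff' measurableSet_Icc).1 h
  filter_upwards [this] with θ hθ hm
  exact hθ (uIcc_subset_Icc hs ht (uIoc_subset_uIcc hm))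

/-- Merges the two Volterra integrals of a 4-PI operator into one integral over `[a,b]`, so that a
composition needs Fubini's theorem on the full square only. -/
lemma integral_piecewise (g₁ g₂ : ℝ → E) (hs : s ∈ Icc a b)
    (h : Integrable (fun θ => if θ ≤ s then g₁ θ else g₂ θ) (leb a b)) :
    (∫ θ in a..s, g₁ θ) + ∫ θ in s..b, g₂ θ = ∫ θ in a..b, if θ ≤ s then g₁ θ else g₂ θ := by
  have hab : a ≤ b := hs.1.trans hs.2
  rw [← intervalIntegral.integral_add_adjacent_intervals
    (intervalIntegrable_of_mem h (left_mem_Icc.2 hab) hs)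
    (intervalIntegrable_of_mem h hs (right_mem_Icc.2 hab))]
  congr 1
  · refine intervalIntegral.integral_congr_ae (ae_of_all _ fun θ hθ => ?_)
    rw [uIoc_of_le hs.1] at hθ
    rw [if_pos hθ.2]
  · refine intervalIntegral.integral_congr_ae (ae_of_all _ fun θ hθ => ?_)
    rw [uIoc_of_le hs.2] at hθ
    rw [if_neg (not_le.2 hθ.1)]

lemma eval_intervalIntegral [Fintype m] {g : ℝ → m → ℝ} (hg : IntervalIntegrable g volume s t)
    (i : m) : (∫ θ in s..t, g θ) i = ∫ θ in s..t, g θ i :=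
  ((ContinuousLinearMap.proj (R := ℝ) (φ := fun _ : m => ℝ) i).intervalIntegral_comp_comm hg).symm

variable [Fintype p]

lemma integrable_mulVec [Fintype m] {μ : Measure ℝ} {M : ℝ → Matrix m p ℝ} {f : ℝ → p → ℝ}
    (h : ∀ i j, Integrable (fun s => M s i j * f s j) μ) : Integrable (fun s => M s *ᵥ f s) μ := by
  refine Integrable.of_eval fun i => ?_
  simp only [Matrix.mulVec, dotProduct]
  exact integrable_finsetSum _ fun j _ => h i j

lemma mulVec_intervalIntegral [Fintype m] (M : Matrix m p ℝ) {g : ℝ → p → ℝ}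
    (hg : IntervalIntegrable g volume s t) :
    M *ᵥ (∫ θ in s..t, g θ) = ∫ θ in s..t, M *ᵥ g θ :=
  ((LinearMap.toContinuousLinearMap (Matrix.mulVecLin M)).intervalIntegral_comp_comm hg).symm

lemma intervalIntegrable_const_mulVec [Fintype m] (M : Matrix m p ℝ) {g : ℝ → p → ℝ}
    (hg : IntervalIntegrable g volume s t) :
    IntervalIntegrable (fun θ => M *ᵥ g θ) volume s t :=
  let L := LinearMap.toContinuousLinearMap (Matrix.mulVecLin M)
  ⟨L.integrable_comp hg.1, L.integrable_comp hg.2⟩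

lemma integral_mulVec_const [Fintype m] {M : ℝ → Matrix m p ℝ} (v : p → ℝ)
    (hM : ∀ i j, IntervalIntegrable (fun θ => M θ i j) volume s t) :
    ∫ θ in s..t, M θ *ᵥ v = matInt s t M *ᵥ v := by
  ext i
  rw [eval_intervalIntegral]
  · simp only [Matrix.mulVec, dotProduct, matInt, Matrix.of_apply]
    rw [intervalIntegral.integral_finsetSum fun j _ => (hM i j).mul_const _]
    simp
  · exact ⟨integrable_mulVec fun i j => (hM i j).1.mul_const _,
      integrable_mulVec fun i j => (hM i j).2.mul_const _⟩

end Integrals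

/-! ### Square integrable matrix functions and kernels -/

section Kernels

variable {a b s t : ℝ} {m p q : Type}

/-- All entries are square integrable on `[a,b]`. -/
def L2Mat (a b : ℝ) (M : ℝ → Matrix m p ℝ) : Prop := ∀ i j, MemLp (fun s => M s i j) 2 (leb a b)

/-- All entries are square integrable on `[a,b]`. -/
def L2Vec (a b : ℝ) (f : ℝ → p → ℝ) : Prop := ∀ j, MemLp (fun s => f s j) 2 (leb a b)

lemma MemLp.integrable_leb {f : ℝ → ℝ} (hf : MemLp f 2 (leb a b)) : Integrable f (leb a b) :=
  hf.integrable (by norm_num)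

lemma _root_.Continuous.memLp_leb {f : ℝ → ℝ} (hf : Continuous f) (r : ENNReal) :
    MemLp f r (leb a b) := by
  obtain ⟨C, hC⟩ := isCompact_Icc.exists_bound_of_continuousOn (s := Icc a b) hf.continuousOn
  exact MemLp.of_bound hf.aestronglyMeasurable C
    ((ae_restrict_iff' measurableSet_Icc).2 (ae_of_all _ fun x hx => hC x hx))

lemma L2Mat.mulVec_integrable [Fintype m] [Fintype p] {M : ℝ → Matrix m p ℝ} {f : ℝ → p → ℝ}
    (hM : L2Mat a b M) (hf : L2Vec a b f) : Integrable (fun s => M s *ᵥ f s) (leb a b) :=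
  integrable_mulVec fun i j => (hM i j).integrable_mul (hf j)

lemma L2Mat.add {M N : ℝ → Matrix m p ℝ} (hM : L2Mat a b M) (hN : L2Mat a b N) :
    L2Mat a b (fun s => M s + N s) := fun i j => (hM i j).add (hN i j)

lemma L2Mat.sub {M N : ℝ → Matrix m p ℝ} (hM : L2Mat a b M) (hN : L2Mat a b N) :
    L2Mat a b (fun s => M s - N s) := fun i j => (hM i j).sub (hN i j)

lemma L2Mat.const_mul [Fintype p] (A : Matrix m p ℝ) {M : ℝ → Matrix p q ℝ} (hM : L2Mat a b M) :
    L2Mat a b (fun s => A * M s) := fun i j => by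
  simp only [Matrix.mul_apply]
  exact memLp_finsetSum _ fun k _ => (hM k j).const_mul _

lemma L2Mat.mul_const [Fintype p] {M : ℝ → Matrix m p ℝ} (hM : L2Mat a b M) (A : Matrix p q ℝ) :
    L2Mat a b (fun s => M s * A) := fun i j => by
  simp only [Matrix.mul_apply]
  exact memLp_finsetSum _ fun k _ => (hM i k).mul_const _

/-- A measurable kernel on `[a,b]²` that is dominated by a square integrable function of its
second variable. -/
def GoodKer (a b : ℝ) (R : ℝ → ℝ → ℝ) : Prop :=
  AEStronglyMeasurable (fun z : ℝ × ℝ => R z.1 z.2) ((leb a b).prod (leb a b)) ∧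
    ∃ h : ℝ → ℝ, MemLp h 2 (leb a b) ∧ ∀ θ ∈ Icc a b, ∀ η ∈ Icc a b, |R θ η| ≤ h η

lemma GoodKer.add {R S : ℝ → ℝ → ℝ} (hR : GoodKer a b R) (hS : GoodKer a b S) :
    GoodKer a b (fun θ η => R θ η + S θ η) := by
  obtain ⟨hRm, h, hh, hRb⟩ := hR
  obtain ⟨hSm, g, hg, hSb⟩ := hS
  exact ⟨hRm.add hSm, _, hh.add hg, fun θ hθ η hη =>
    (abs_add_le _ _).trans (add_le_add (hRb θ hθ η hη) (hSb θ hθ η hη))⟩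

lemma goodKer_of_continuous {R : ℝ → ℝ → ℝ} (hR : Continuous fun z : ℝ × ℝ => R z.1 z.2) :
    GoodKer a b R := by
  obtain ⟨C, hC⟩ := (isCompact_Icc.prod isCompact_Icc).exists_bound_of_continuousOn
    (s := Icc a b ×ˢ Icc a b) hR.continuousOn
  exact ⟨hR.aestronglyMeasurable, fun _ => C, memLp_const C,
    fun θ hθ η hη => hC (θ, η) ⟨hθ, hη⟩⟩

lemma goodKer_mul {f g : ℝ → ℝ} (hf : Continuous f) (hg : MemLp g 2 (leb a b)) :
    GoodKer a b (fun θ η => f θ * g η) := by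
  obtain ⟨C, hC⟩ := isCompact_Icc.exists_bound_of_continuousOn (s := Icc a b) hf.continuousOn
  refine ⟨(hf.comp continuous_fst).aestronglyMeasurable.mul hg.1.comp_snd,
    fun η => C * |g η|, hg.abs.const_mul C, fun θ hθ η _ => ?_⟩
  rw [abs_mul]
  exact mul_le_mul_of_nonneg_right (hC θ hθ) (abs_nonneg _)

lemma GoodKer.sum {ι : Type} (u : Finset ι) {R : ι → ℝ → ℝ → ℝ} (hR : ∀ i, GoodKer a b (R i)) :
    GoodKer a b (fun θ η => ∑ i ∈ u, R i θ η) := by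
  classical
  induction u using Finset.induction_on with
  | empty =>
    simpa using goodKer_of_continuous (a := a) (b := b) (R := fun _ _ => 0) continuous_const
  | insert i u hi ih => simpa only [Finset.sum_insert hi] using (hR i).add ih

/-- The triangle below the diagonal is measurable, so a jump across the diagonal does no harm. This
is the shape of the kernel of a 4-PI operator. -/
lemma GoodKer.ite {R S : ℝ → ℝ → ℝ} (hR : GoodKer a b R) (hS : GoodKer a b S) :
    GoodKer a b (fun θ η => if η ≤ θ then R θ η else S θ η) := by
  classical
  obtain ⟨hRm, h, hh, hRb⟩ := hR
  obtain ⟨hSm, g, hg, hSb⟩ := hS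
  refine ⟨?_, fun η => |h η| + |g η|, hh.abs.add hg.abs, fun θ hθ η hη => ?_⟩
  · have hset : MeasurableSet {z : ℝ × ℝ | z.2 ≤ z.1} :=
      measurableSet_le measurable_snd measurable_fst
    have := AEStronglyMeasurable.piecewise (μ := (leb a b).prod (leb a b)) hset
      hRm.restrict hSm.restrict
    exact this
  · dsimp only
    split_ifs
    · exact ((hRb θ hθ η hη).trans (le_abs_self _)).trans (le_add_of_nonneg_right (abs_nonneg _))
    · exact ((hSb θ hθ η hη).trans (le_abs_self _)).trans (le_add_of_nonneg_left (abs_nonneg _))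

lemma ae_mem_leb : ∀ᵐ s ∂leb a b, s ∈ Icc a b := ae_restrict_mem measurableSet_Icc

lemma ae_mem_leb_prod : ∀ᵐ z ∂(leb a b).prod (leb a b), z.1 ∈ Icc a b ∧ z.2 ∈ Icc a b := by
  rw [Measure.prod_restrict]
  exact ae_restrict_mem (measurableSet_Icc.prod measurableSet_Icc)

/-- Integrability of `k(θ) R(θ,η) f(η)` on the square. -/
lemma GoodKer.integrable_prod {R : ℝ → ℝ → ℝ} (hR : GoodKer a b R) {k f : ℝ → ℝ}
    (hk : Integrable k (leb a b)) (hf : MemLp f 2 (leb a b)) :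
    Integrable (fun z : ℝ × ℝ => k z.1 * (R z.1 z.2 * f z.2)) ((leb a b).prod (leb a b)) := by
  obtain ⟨hm, h, hh, hb⟩ := hR
  -- The dominating function separates: `k` is integrable in the first variable, and `h * f` in the
  -- second as a product of two `L₂` functions.
  have hdom : Integrable (fun z : ℝ × ℝ => k z.1 * (h z.2 * f z.2))
      ((leb a b).prod (leb a b)) := hk.mul_prod (hh.integrable_mul hf)
  refine hdom.mono (hk.1.comp_fst.mul (hm.mul hf.1.comp_snd)) ?_
  filter_upwards [ae_mem_leb_prod] with z hz
  simp only [norm_mul]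
  have := (hb _ hz.1 _ hz.2).trans (le_abs_self _)
  rw [← Real.norm_eq_abs, ← Real.norm_eq_abs] at this
  gcongr

/-- For almost every first variable, the section of a kernel is square integrable. -/
lemma GoodKer.ae_memLp_right {R : ℝ → ℝ → ℝ} (hR : GoodKer a b R) :
    ∀ᵐ θ ∂leb a b, MemLp (R θ) 2 (leb a b) := by
  obtain ⟨hm, h, hh, hb⟩ := hR
  filter_upwards [hm.prodMk_left, ae_mem_leb] with θ h1 h2
  refine hh.mono h1 ?_
  filter_upwards [ae_mem_leb] with η hη
  exact (hb θ h2 η hη).trans (le_abs_self _)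

/-- For almost every second variable, the section of a kernel is square integrable. -/
lemma GoodKer.ae_memLp_left {R : ℝ → ℝ → ℝ} (hR : GoodKer a b R) :
    ∀ᵐ η ∂leb a b, MemLp (fun θ => R θ η) 2 (leb a b) := by
  obtain ⟨hm, h, hh, hb⟩ := hR
  filter_upwards [hm.prod_swap.prodMk_left, ae_mem_leb] with η h1 h2
  -- The dominating function depends on `η` only, so this section is bounded by a constant.
  refine MemLp.of_bound h1 (h η) ?_
  filter_upwards [ae_mem_leb] with θ hθ
  exact hb θ hθ η h2

/-- Integrating a kernel against a function of its first variable gives an `L₂` function. -/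
lemma GoodKer.memLp_integral {R : ℝ → ℝ → ℝ} (hR : GoodKer a b R) {k : ℝ → ℝ}
    (hk : Integrable k (leb a b)) :
    MemLp (fun η => ∫ θ, k θ * R θ η ∂leb a b) 2 (leb a b) := by
  obtain ⟨hm, h, hh, hb⟩ := hR
  have h1 : AEStronglyMeasurable (fun η => ∫ θ, k θ * R θ η ∂leb a b) (leb a b) :=
    AEStronglyMeasurable.integral_prod_right' (f := fun z : ℝ × ℝ => k z.2 * R z.2 z.1)
      (hk.1.comp_snd.mul hm.prod_swap)
  -- The bound `h η` is uniform in `θ`, so the integral is at most `‖k‖₁ * h η`, which is square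
  -- integrable in `η`.
  refine (hh.const_mul (∫ θ, |k θ| ∂leb a b)).mono h1 ?_
  filter_upwards [ae_mem_leb] with η hη
  rw [norm_mul]
  refine (norm_integral_le_of_norm_le (g := fun θ => |k θ| * h η) (hk.abs.mul_const _) ?_).trans ?_
  · filter_upwards [ae_mem_leb] with θ hθ
    rw [norm_mul]
    exact mul_le_mul_of_nonneg_left (hb θ hθ η hη) (abs_nonneg _)
  · rw [integral_mul_const]
    exact mul_le_mul (le_abs_self _) (le_abs_self _)
      ((abs_nonneg _).trans (hb η hη η hη)) (abs_nonneg _)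

variable [Fintype m] [Fintype p] [Fintype q]

/-- Fubini's theorem for the composition of a row and a kernel operator. -/
theorem integral_kernel_comp (hab : a ≤ b) {k : ℝ → Matrix m p ℝ} {R : ℝ → ℝ → Matrix p q ℝ}
    {f : ℝ → q → ℝ} (hk : L2Mat a b k) (hR : ∀ i j, GoodKer a b fun θ η => R θ η i j)
    (hf : L2Vec a b f) :
    (∫ θ in a..b, k θ *ᵥ ∫ η in a..b, R θ η *ᵥ f η) =
        ∫ η in a..b, (matInt a b fun θ => k θ * R θ η) *ᵥ f η ∧
      Integrable (fun θ => k θ *ᵥ ∫ η in a..b, R θ η *ᵥ f η) (leb a b) ∧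
      Integrable (fun η => (matInt a b fun θ => k θ * R θ η) *ᵥ f η) (leb a b) := by
  have hG : Integrable (fun z : ℝ × ℝ => k z.1 *ᵥ (R z.1 z.2 *ᵥ f z.2))
      ((leb a b).prod (leb a b)) := by
    refine Integrable.of_eval fun i => ?_
    simp only [Matrix.mulVec, dotProduct, Finset.mul_sum]
    exact integrable_finsetSum _ fun j _ => integrable_finsetSum _ fun l _ =>
      (hR j l).integrable_prod (MemLp.integrable_leb (hk i j)) (hf l)
  have hR1 : ∀ᵐ θ ∂leb a b, ∀ i j, MemLp (fun η => R θ η i j) 2 (leb a b) :=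
    ae_all_iff.2 fun i => ae_all_iff.2 fun j => (hR i j).ae_memLp_right
  have hR2 : ∀ᵐ η ∂leb a b, ∀ i j, MemLp (fun θ => R θ η i j) 2 (leb a b) :=
    ae_all_iff.2 fun i => ae_all_iff.2 fun j => (hR i j).ae_memLp_left
  have ha := left_mem_Icc.2 hab
  have hb := right_mem_Icc.2 hab
  -- Sections of the kernel are known to be square integrable only for almost every value of the
  -- other variable, so a matrix can be moved through an inner integral only almost everywhere.
  have e1 : (fun θ => ∫ η, k θ *ᵥ (R θ η *ᵥ f η) ∂leb a b) =ᵐ[leb a b]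
      fun θ => k θ *ᵥ ∫ η in a..b, R θ η *ᵥ f η := by
    filter_upwards [hR1] with θ hθ
    have : L2Mat a b (R θ) := hθ
    rw [mulVec_intervalIntegral _ (intervalIntegrable_of_mem (this.mulVec_integrable hf) ha hb),
      intervalIntegral_eq_leb hab]
  have e2 : (fun η => ∫ θ, k θ *ᵥ (R θ η *ᵥ f η) ∂leb a b) =ᵐ[leb a b]
      fun η => (matInt a b fun θ => k θ * R θ η) *ᵥ f η := by
    filter_upwards [hR2] with η hη
    rw [← integral_mulVec_const, intervalIntegral_eq_leb hab]
    · simp only [Matrix.mulVec_mulVec]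
    · intro i j
      refine intervalIntegrable_of_mem ?_ ha hb
      simp only [Matrix.mul_apply]
      exact integrable_finsetSum _ fun l _ => (hk i l).integrable_mul (hη l j)
  refine ⟨?_, hG.integral_prod_left.congr e1, hG.integral_prod_right.congr e2⟩
  rw [intervalIntegral_eq_leb hab, intervalIntegral_eq_leb hab, ← integral_congr_ae e1,
    ← integral_congr_ae e2]
  exact integral_integral_swap hG

end Kernels

/-! ### Entrywise integrals of matrix functions -/

section MatInt

variable {a b s t : ℝ} {m p q : Type}

/-- Agreement on the open interval suffices, so the values of a kernel on the diagonal play no role.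
-/
lemma matInt_congr {M N : ℝ → Matrix p q ℝ} (hst : s ≤ t) (h : ∀ θ ∈ Ioo s t, M θ = N θ) :
    matInt s t M = matInt s t N := by
  ext i j
  simp only [matInt, Matrix.of_apply]
  have : ∀ᵐ θ ∂(volume : Measure ℝ), θ ≠ t := by simp [ae_iff, measure_singleton]
  refine intervalIntegral.integral_congr_ae ?_
  filter_upwards [this] with θ hθ hm
  rw [uIoc_of_le hst] at hm
  rw [h θ ⟨hm.1, lt_of_le_of_ne hm.2 hθ⟩]

lemma matInt_add_adjacent {M : ℝ → Matrix p q ℝ}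
    (hM : ∀ i j, Integrable (fun θ => M θ i j) (leb a b)) {x y z : ℝ}
    (hx : x ∈ Icc a b) (hy : y ∈ Icc a b) (hz : z ∈ Icc a b) :
    matInt x y M + matInt y z M = matInt x z M := by
  ext i j
  exact intervalIntegral.integral_add_adjacent_intervals
    (intervalIntegrable_of_mem (hM i j) hx hy) (intervalIntegrable_of_mem (hM i j) hy hz)

lemma L2Mat.mul_integrable [Fintype p] {M : ℝ → Matrix m p ℝ} {N : ℝ → Matrix p q ℝ}
    (hM : L2Mat a b M) (hN : L2Mat a b N) (i : m) (j : q) :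
    Integrable (fun θ => (M θ * N θ) i j) (leb a b) := by
  simp only [Matrix.mul_apply]
  exact integrable_finsetSum _ fun l _ => (hM i l).integrable_mul (hN l j)

lemma L2Mat.mul_bounded [Fintype p] {M : ℝ → Matrix m p ℝ} {N : ℝ → Matrix p q ℝ}
    (hM : L2Mat a b M) (hN : ∀ i j, MemLp (fun s => N s i j) ⊤ (leb a b)) :
    L2Mat a b (fun θ => M θ * N θ) := fun i j => by
  simp only [Matrix.mul_apply]
  exact memLp_finsetSum _ fun l _ => (hN l j).mul (hM i l)

lemma L2Mat.ite {M N : ℝ → Matrix p q ℝ} (hM : L2Mat a b M) (hN : L2Mat a b N) (s : ℝ) :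
    L2Mat a b (fun θ => if θ ≤ s then M θ else N θ) := fun i j => by
  classical
  have := MemLp.piecewise (μ := leb a b) (s := Iic s) measurableSet_Iic ((hM i j).restrict _)
    ((hN i j).restrict _)
  refine this.congr_norm ?_ (ae_of_all _ fun θ => ?_)
  · refine this.1.congr (ae_of_all _ fun θ => ?_)
    by_cases h : θ ≤ s <;> simp [Set.piecewise, h]
  · by_cases h : θ ≤ s <;> simp [Set.piecewise, h]

end MatInt

/-! ### Composition of 4-PI operators -/

namespace FourPI

variable {a b s : ℝ} {m k l p q r : Type}

/-- The kernel of the integral part of a 4-PI operator. -/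
def kernel (K : FourPI m k p q) (s θ : ℝ) : Matrix p q ℝ :=
  if θ ≤ s then K.R₁ s θ else K.R₂ s θ

/-- Sufficient regularity of the inner operator of a composition. -/
structure Regular (a b : ℝ) (L : FourPI k l q r) : Prop where
  Q₁ : L2Mat a b L.Q₁
  Q₂ : L2Mat a b L.Q₂
  R₀ : ∀ i j, MemLp (fun s => L.R₀ s i j) ⊤ (leb a b)
  goodKer : ∀ i j, GoodKer a b fun s θ => L.kernel s θ i j

variable [Fintype m] [Fintype k] [Fintype l] [Fintype p] [Fintype q] [Fintype r]

lemma fn_eq_kernel (K : FourPI m k p q) (u : k → ℝ) (f : ℝ → q → ℝ) (hs : s ∈ Icc a b)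
    (h : Integrable (fun θ => K.kernel s θ *ᵥ f θ) (leb a b)) :
    K.fn a b u f s = K.Q₂ s *ᵥ u + (K.R₀ s *ᵥ f s + ∫ θ in a..b, K.kernel s θ *ᵥ f θ) := by
  have e : (fun θ => K.kernel s θ *ᵥ f θ) =
      fun θ => if θ ≤ s then K.R₁ s θ *ᵥ f θ else K.R₂ s θ *ᵥ f θ := by
    funext θ; unfold kernel; split_ifs <;> rfl
  rw [e] at h ⊢
  rw [← integral_piecewise _ _ hs h, fn, add_assoc]

lemma Regular.ae_section {L : FourPI k l q r} (hL : L.Regular a b) :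
    ∀ᵐ s ∂leb a b, L2Mat a b (L.kernel s) :=
  ae_all_iff.2 fun i => ae_all_iff.2 fun j => (hL.goodKer i j).ae_memLp_right

lemma Regular.ae_section' {L : FourPI k l q r} (hL : L.Regular a b) :
    ∀ᵐ η ∂leb a b, L2Mat a b (fun θ => L.kernel θ η) :=
  ae_all_iff.2 fun i => ae_all_iff.2 fun j => (hL.goodKer i j).ae_memLp_left

/-- Integration of the distributed part of a 4-PI operator against a row. -/
lemma Regular.row_comp (hab : a ≤ b) {L : FourPI k l q r} (hL : L.Regular a b)
    {κ : ℝ → Matrix p q ℝ} (hκ : L2Mat a b κ) (u : l → ℝ) {f : ℝ → r → ℝ} (hf : L2Vec a b f) :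
    (∫ θ in a..b, κ θ *ᵥ L.fn a b u f θ) = (matInt a b fun θ => κ θ * L.Q₂ θ) *ᵥ u +
        ∫ η in a..b, (κ η * L.R₀ η + matInt a b fun θ => κ θ * L.kernel θ η) *ᵥ f η ∧
      Integrable (fun θ => κ θ *ᵥ L.fn a b u f θ) (leb a b) ∧
      Integrable (fun η => (κ η * L.R₀ η + matInt a b fun θ => κ θ * L.kernel θ η) *ᵥ f η)
        (leb a b) := by
  have ha := left_mem_Icc.2 hab
  have hb := right_mem_Icc.2 hab
  obtain ⟨h1, h2, h3⟩ := integral_kernel_comp hab hκ hL.goodKer hf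
  have i1 : Integrable (fun θ => (κ θ * L.Q₂ θ) *ᵥ u) (leb a b) :=
    integrable_mulVec fun i j => (hκ.mul_integrable hL.Q₂ i j).mul_const _
  have i2 : Integrable (fun θ => (κ θ * L.R₀ θ) *ᵥ f θ) (leb a b) :=
    (hκ.mul_bounded hL.R₀).mulVec_integrable hf
  have e : (fun θ => κ θ *ᵥ L.fn a b u f θ) =ᵐ[leb a b] fun θ => (κ θ * L.Q₂ θ) *ᵥ u +
      ((κ θ * L.R₀ θ) *ᵥ f θ + κ θ *ᵥ ∫ η in a..b, L.kernel θ η *ᵥ f η) := by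
    filter_upwards [hL.ae_section, ae_mem_leb] with θ hθ hm
    rw [L.fn_eq_kernel u f hm (hθ.mulVec_integrable hf)]
    simp only [Matrix.mulVec_add, Matrix.mulVec_mulVec]
  have e' : (fun η => (κ η * L.R₀ η + matInt a b fun θ => κ θ * L.kernel θ η) *ᵥ f η) =
      fun η => (κ η * L.R₀ η) *ᵥ f η + (matInt a b fun θ => κ θ * L.kernel θ η) *ᵥ f η := by
    funext η; rw [Matrix.add_mulVec]
  have J {g : ℝ → p → ℝ} (hg : Integrable g (leb a b)) : IntervalIntegrable g volume a b :=
    intervalIntegrable_of_mem hg ha hb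
  have i3 : Integrable (fun θ => (κ θ * L.R₀ θ) *ᵥ f θ +
      κ θ *ᵥ ∫ η in a..b, L.kernel θ η *ᵥ f η) (leb a b) := i2.add h2
  refine ⟨?_, (i1.add i3).congr e.symm, e' ▸ i2.add h3⟩
  rw [intervalIntegral_congr_leb e ha hb, e', intervalIntegral.integral_add (J i1) (J i3),
    intervalIntegral.integral_add (J i2) (J h2), intervalIntegral.integral_add (J i2) (J h3), h1,
    integral_mulVec_const u fun i j =>
      intervalIntegrable_of_mem (hκ.mul_integrable hL.Q₂ i j) ha hb]

/-- Here the integration runs over the first variable of the kernel. It lies below `η` on `[a,η]`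
and above `η` on `[η,b]`, so `R₂` comes first and `R₁` second, the reverse of the order in `fn`. -/
lemma Regular.matInt_kernel {L : FourPI k l q r} (hL : L.Regular a b)
    {κ : ℝ → Matrix p q ℝ} (hκ : L2Mat a b κ) :
    ∀ᵐ η ∂leb a b, (matInt a b fun θ => κ θ * L.kernel θ η) =
      (matInt a η fun θ => κ θ * L.R₂ θ η) + matInt η b fun θ => κ θ * L.R₁ θ η := by
  filter_upwards [hL.ae_section', ae_mem_leb] with η hη hm
  have hab := hm.1.trans hm.2
  rw [← matInt_add_adjacent (fun i j => hκ.mul_integrable hη i j) (left_mem_Icc.2 hab) hm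
    (right_mem_Icc.2 hab)]
  congr 1
  · exact matInt_congr hm.1 fun θ hθ => by rw [kernel, if_neg (not_le.2 hθ.2)]
  · exact matInt_congr hm.2 fun θ hθ => by rw [kernel, if_pos hθ.1.le]

/-- The finite-dimensional part of a composition. -/
theorem fin_comp (hab : a ≤ b) {K : FourPI m k p q} {L : FourPI k l q r} (hK : L2Mat a b K.Q₁)
    (hL : L.Regular a b) (u : l → ℝ) {f : ℝ → r → ℝ} (hf : L2Vec a b f) :
    K.fin a b (L.fin a b u f) (L.fn a b u f) = (K.comp a b L).fin a b u f ∧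
      Integrable (fun s => (K.comp a b L).Q₁ s *ᵥ f s) (leb a b) := by
  have ha := left_mem_Icc.2 hab
  have hb := right_mem_Icc.2 hab
  obtain ⟨h1, h2, h3⟩ := hL.row_comp hab hK u hf
  have i1 : Integrable (fun s => L.Q₁ s *ᵥ f s) (leb a b) := hL.Q₁.mulVec_integrable hf
  have i2 : Integrable (fun s => (K.P * L.Q₁ s) *ᵥ f s) (leb a b) :=
    (hL.Q₁.const_mul K.P).mulVec_integrable hf
  have e : (fun s => (K.comp a b L).Q₁ s *ᵥ f s) =ᵐ[leb a b] fun s => (K.P * L.Q₁ s) *ᵥ f s +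
      (K.Q₁ s * L.R₀ s + matInt a b fun θ => K.Q₁ θ * L.kernel θ s) *ᵥ f s := by
    filter_upwards [hL.matInt_kernel hK] with s hs
    rw [hs, ← Matrix.add_mulVec]
    congr 1
    simp only [comp]
    abel
  refine ⟨?_, (i2.add h3).congr e.symm⟩
  have J {g : ℝ → m → ℝ} (hg : Integrable g (leb a b)) : IntervalIntegrable g volume a b :=
    intervalIntegrable_of_mem hg ha hb
  rw [fin, h1, fin, fin, intervalIntegral_congr_leb e ha hb,
    intervalIntegral.integral_add (J i2) (J h3), Matrix.mulVec_add,
    mulVec_intervalIntegral _ (intervalIntegrable_of_mem i1 ha hb)]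
  simp only [comp, Matrix.add_mulVec, Matrix.mulVec_mulVec]
  abel

/-- The kernel of a composition. -/
lemma Regular.kernel_comp {K : FourPI m k p q} {L : FourPI k l q r}
    (hL : L.Regular a b) (hs : s ∈ Icc a b) (hK : L2Mat a b (K.kernel s)) :
    ∀ᵐ η ∂leb a b, (K.comp a b L).kernel s η = K.Q₂ s * L.Q₁ η + K.R₀ s * L.kernel s η +
      (K.kernel s η * L.R₀ η + matInt a b fun θ => K.kernel s θ * L.kernel θ η) := by
  filter_upwards [hL.ae_section', ae_mem_leb] with η hη hm
  have hab := hm.1.trans hm.2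
  have ha := left_mem_Icc.2 hab
  have hb := right_mem_Icc.2 hab
  have hi := fun i j => hK.mul_integrable hη i j
  -- The range of `θ` is split at both `s` and `η`. On each of the three pieces both kernels stay on
  -- one branch, and the order of `s` and `η` decides whether the three integrals are those of `R₁`
  -- or of `R₂` in `comp`.
  rcases le_or_gt η s with h | h
  · rw [← matInt_add_adjacent hi ha hm hb, ← matInt_add_adjacent hi hm hs hb,
      matInt_congr (N := fun θ => K.R₁ s θ * L.R₂ θ η) hm.1 fun θ hθ => ?_,
      matInt_congr (N := fun θ => K.R₁ s θ * L.R₁ θ η) h fun θ hθ => ?_,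
      matInt_congr (N := fun θ => K.R₂ s θ * L.R₁ θ η) hs.2 fun θ hθ => ?_]
    · simp only [kernel, if_pos h, comp]
      abel
    · rw [kernel, kernel, if_neg (not_le.2 hθ.1), if_pos (h.trans hθ.1.le)]
    · rw [kernel, kernel, if_pos hθ.2.le, if_pos hθ.1.le]
    · rw [kernel, kernel, if_pos (hθ.2.le.trans h), if_neg (not_le.2 hθ.2)]
  · rw [← matInt_add_adjacent hi ha hs hb, ← matInt_add_adjacent hi hs hm hb,
      matInt_congr (N := fun θ => K.R₁ s θ * L.R₂ θ η) hs.1 fun θ hθ => ?_,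
      matInt_congr (N := fun θ => K.R₂ s θ * L.R₂ θ η) h.le fun θ hθ => ?_,
      matInt_congr (N := fun θ => K.R₂ s θ * L.R₁ θ η) hm.2 fun θ hθ => ?_]
    · simp only [kernel, if_neg (not_le.2 h), comp]
      abel
    · rw [kernel, kernel, if_neg (not_le.2 (h.trans hθ.1)), if_pos hθ.1.le]
    · rw [kernel, kernel, if_neg (not_le.2 hθ.1), if_neg (not_le.2 hθ.2)]
    · rw [kernel, kernel, if_pos hθ.2.le, if_neg (not_le.2 (hθ.2.trans h))]

/-- The distributed part of a composition. -/
theorem fn_comp (hab : a ≤ b) {K : FourPI m k p q} {L : FourPI k l q r}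
    (hK₁ : ∀ᵐ s ∂leb a b, L2Mat a b (K.R₁ s)) (hK₂ : ∀ᵐ s ∂leb a b, L2Mat a b (K.R₂ s))
    (hL : L.Regular a b) (u : l → ℝ) {f : ℝ → r → ℝ} (hf : L2Vec a b f) :
    K.fn a b (L.fin a b u f) (L.fn a b u f) =ᵐ[leb a b] (K.comp a b L).fn a b u f := by
  have ha := left_mem_Icc.2 hab
  have hb := right_mem_Icc.2 hab
  filter_upwards [hK₁, hK₂, hL.ae_section, ae_mem_leb] with s h1 h2 h3 hs
  -- For fixed `s` the integral part of the outer operator is integration against the row `K.kernel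
  -- s`, so the formula for rows applies to it.
  have hκ : L2Mat a b (K.kernel s) := h1.ite h2 s
  obtain ⟨r1, r2, r3⟩ := hL.row_comp hab hκ u hf
  have i1 : Integrable (fun η => L.Q₁ η *ᵥ f η) (leb a b) := hL.Q₁.mulVec_integrable hf
  have i2 : Integrable (fun η => L.kernel s η *ᵥ f η) (leb a b) := h3.mulVec_integrable hf
  have j1 : Integrable (fun η => (K.Q₂ s * L.Q₁ η) *ᵥ f η) (leb a b) :=
    (hL.Q₁.const_mul _).mulVec_integrable hf
  have j2 : Integrable (fun η => (K.R₀ s * L.kernel s η) *ᵥ f η) (leb a b) :=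
    (h3.const_mul _).mulVec_integrable hf
  have j3 : Integrable (fun η => (K.Q₂ s * L.Q₁ η) *ᵥ f η + (K.R₀ s * L.kernel s η) *ᵥ f η)
      (leb a b) := j1.add j2
  have e : (fun η => (K.comp a b L).kernel s η *ᵥ f η) =ᵐ[leb a b] fun η =>
      ((K.Q₂ s * L.Q₁ η) *ᵥ f η + (K.R₀ s * L.kernel s η) *ᵥ f η) +
      (K.kernel s η * L.R₀ η + matInt a b fun θ => K.kernel s θ * L.kernel θ η) *ᵥ f η := by
    filter_upwards [hL.kernel_comp hs hκ] with η hη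
    rw [hη, Matrix.add_mulVec, Matrix.add_mulVec]
  have J {g : ℝ → p → ℝ} (hg : Integrable g (leb a b)) : IntervalIntegrable g volume a b :=
    intervalIntegrable_of_mem hg ha hb
  have hQ : (K.comp a b L).Q₂ s = K.Q₂ s * L.P + K.R₀ s * L.Q₂ s +
      matInt a b fun θ => K.kernel s θ * L.Q₂ θ := by
    rw [← matInt_add_adjacent (fun i j => hκ.mul_integrable hL.Q₂ i j) ha hs hb,
      matInt_congr (N := fun θ => K.R₁ s θ * L.Q₂ θ) hs.1 fun θ hθ => ?_,
      matInt_congr (N := fun θ => K.R₂ s θ * L.Q₂ θ) hs.2 fun θ hθ => ?_]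
    · simp only [comp]
      abel
    · rw [kernel, if_neg (not_le.2 hθ.1)]
    · rw [kernel, if_pos hθ.2.le]
  rw [fn_eq_kernel K _ _ hs r2, fn_eq_kernel (K.comp a b L) u f hs
    ((j3.add r3).congr e.symm), intervalIntegral_congr_leb e ha hb,
    intervalIntegral.integral_add (J j3) (J r3),
    intervalIntegral.integral_add (J j1) (J j2), r1, fn_eq_kernel L u f hs i2, hQ, fin,
    show (K.comp a b L).R₀ s = K.R₀ s * L.R₀ s from rfl]
  simp only [Matrix.mulVec_add, mulVec_intervalIntegral _ (intervalIntegrable_of_mem i1 ha hb),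
    mulVec_intervalIntegral _ (intervalIntegrable_of_mem i2 ha hb), Matrix.add_mulVec,
    Matrix.mulVec_mulVec]
  abel

lemma fin_congr_ae (hab : a ≤ b) (K : FourPI m k p q) (u : k → ℝ) {f g : ℝ → q → ℝ}
    (h : f =ᵐ[leb a b] g) : K.fin a b u f = K.fin a b u g := by
  rw [fin, fin, intervalIntegral_congr_leb (g₂ := fun θ => K.Q₁ θ *ᵥ g θ)
    (h.mono fun θ hθ => by simp only [hθ]) (left_mem_Icc.2 hab) (right_mem_Icc.2 hab)]

lemma fn_congr_ae (hab : a ≤ b) (K : FourPI m k p q) (u : k → ℝ) {f g : ℝ → q → ℝ}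
    (h : f =ᵐ[leb a b] g) : K.fn a b u f =ᵐ[leb a b] K.fn a b u g := by
  filter_upwards [h, ae_mem_leb] with s hs hm
  rw [fn, fn, hs, intervalIntegral_congr_leb (g₂ := fun θ => K.R₁ s θ *ᵥ g θ)
    (h.mono fun θ hθ => by simp only [hθ]) (left_mem_Icc.2 hab) hm,
    intervalIntegral_congr_leb (g₂ := fun θ => K.R₂ s θ *ᵥ g θ)
    (h.mono fun θ hθ => by simp only [hθ]) hm (right_mem_Icc.2 hab)]

end FourPI

/-! ### Absolute continuity and Taylor's formula in `W_k[a,b]` -/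

section Sobolev

variable {a b : ℝ}

lemma _root_.AbsolutelyContinuousOnInterval.congr {X : Type} [PseudoMetricSpace X] {f g : ℝ → X}
    {x y : ℝ} (hf : AbsolutelyContinuousOnInterval f x y) (h : EqOn f g (uIcc x y)) :
    AbsolutelyContinuousOnInterval g x y := by
  rw [absolutelyContinuousOnInterval_iff] at hf ⊢
  intro ε hε
  obtain ⟨δ, hδ, H⟩ := hf ε hε
  refine ⟨δ, hδ, fun E hE hl => ?_⟩
  refine lt_of_eq_of_lt (Finset.sum_congr rfl fun i hi => ?_) (H E hE hl)
  rw [h (hE.1 i hi).1, h (hE.1 i hi).2]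

/-- Applied to bounded linear maps, it moves absolute continuity between `ℝL₂` and its two factors.
-/
lemma _root_.AbsolutelyContinuousOnInterval.comp_lipschitz {X Y : Type} [PseudoMetricSpace X]
    [PseudoMetricSpace Y] {f : ℝ → X} {x y : ℝ} {K : NNReal} {φ : X → Y}
    (hf : AbsolutelyContinuousOnInterval f x y) (hφ : LipschitzWith K φ) :
    AbsolutelyContinuousOnInterval (fun t => φ (f t)) x y := by
  unfold AbsolutelyContinuousOnInterval at hf ⊢
  have hf' := Filter.Tendsto.const_mul (K : ℝ) hf
  rw [mul_zero] at hf'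
  refine squeeze_zero (fun E => Finset.sum_nonneg fun i _ => dist_nonneg) (fun E => ?_) hf'
  rw [Finset.mul_sum]
  exact Finset.sum_le_sum fun i _ => hφ.dist_le_mul _ _

/-- The two derivatives can differ only at the end points, where `derivWithin` is one-sided. -/
lemma derivWithin_ae_eq_deriv (f : ℝ → ℝ) :
    derivWithin f (Icc a b) =ᵐ[leb a b] deriv f := by
  rw [leb, ← Measure.restrict_congr_set Ioo_ae_eq_Icc]
  filter_upwards [ae_restrict_mem measurableSet_Ioo] with s hs
  exact derivWithin_of_mem_nhds (Icc_mem_nhds hs.1 hs.2)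

lemma deriv_ae_eq_iteratedDerivWithin (u : ℝ → ℝ) (j : ℕ) :
    deriv (iteratedDerivWithin j u (Icc a b)) =ᵐ[leb a b]
      iteratedDerivWithin (j + 1) u (Icc a b) := by
  rw [iteratedDerivWithin_succ]
  exact (derivWithin_ae_eq_deriv _).symm

lemma tau_zero_right (j : ℕ) : tau j 0 = if j = 0 then 1 else 0 := by
  by_cases h : j = 0 <;> simp [tau, h]

lemma continuous_tau (j : ℕ) : Continuous (tau j) := by unfold tau; fun_prop

lemma hasDerivAt_tau (j : ℕ) (s : ℝ) : HasDerivAt (tau (j + 1)) (tau j s) s := by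
  have h := (hasDerivAt_pow (j + 1) s).div_const ((j + 1).factorial : ℝ)
  have e : tau j s = ((j + 1 : ℕ) : ℝ) * s ^ (j + 1 - 1) / ((j + 1).factorial : ℝ) := by
    rw [tau, Nat.factorial_succ, Nat.cast_mul, Nat.add_sub_cancel]
    exact (mul_div_mul_left _ _ (Nat.cast_ne_zero.2 j.succ_ne_zero)).symm
  rw [e]
  exact h

/-- Taylor's formula with integral remainder in a Sobolev space. -/
theorem MemW.taylor {k : ℕ} {u : ℝ → ℝ} (h : MemW a b k u) {s : ℝ} (hs : s ∈ Icc a b)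
    (j m : ℕ) (hk : j + m + 1 ≤ k) :
    iteratedDerivWithin j u (Icc a b) s =
      (∑ i ∈ Finset.range (m + 1), tau i (s - a) * iteratedDerivWithin (j + i) u (Icc a b) a) +
      ∫ θ in a..s, tau m (s - θ) * iteratedDerivWithin (j + m + 1) u (Icc a b) θ := by
  have hab := hs.1.trans hs.2
  have ha := left_mem_Icc.2 hab
  have hsub : uIcc a s ⊆ uIcc a b := uIcc_subset_uIcc_left (by rwa [uIcc_of_le hab])
  induction m with
  | zero =>
    have hac := (h.1 j (by omega)).mono hsub
    have h1 := hac.integral_deriv_eq_sub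
    rw [intervalIntegral_congr_leb (deriv_ae_eq_iteratedDerivWithin u j) ha hs] at h1
    simp only [zero_add, Finset.range_one, Finset.sum_singleton, tau, pow_zero,
      Nat.factorial_zero, Nat.cast_one, div_one, one_mul, add_zero]
    linarith
  | succ m ih =>
    rw [ih (by omega), Finset.sum_range_succ _ (m + 1)]
    have hg := (h.1 (j + m + 1) (by omega)).mono hsub
    have hd : ∀ θ, HasDerivAt (fun θ => tau (m + 1) (s - θ)) (-tau m (s - θ)) θ := fun θ => by
      have := (hasDerivAt_tau m (s - θ)).comp θ ((hasDerivAt_id θ).const_sub s)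
      rwa [mul_neg_one] at this
    have hf : AbsolutelyContinuousOnInterval (fun θ => tau (m + 1) (s - θ)) a s := by
      apply ContDiffOn.absolutelyContinuousOnInterval
      apply ContDiff.contDiffOn
      unfold tau
      fun_prop
    -- Integration by parts: the boundary term at `θ = s` vanishes because `tau (m + 1) 0 = 0`, and
    -- the one at `θ = a` is the next Taylor term.
    have h1 := hf.integral_mul_deriv_eq_deriv_mul hg
    have e1 : (fun θ => tau (m + 1) (s - θ) *
        deriv (iteratedDerivWithin (j + m + 1) u (Icc a b)) θ) =ᵐ[leb a b] fun θ =>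
        tau (m + 1) (s - θ) * iteratedDerivWithin (j + m + 1 + 1) u (Icc a b) θ :=
      (deriv_ae_eq_iteratedDerivWithin u (j + m + 1)).mono fun θ hθ => by simp only [hθ]
    rw [intervalIntegral_congr_leb e1 ha hs] at h1
    simp only [fun θ => (hd θ).deriv, sub_self, tau_zero_right, neg_mul,
      intervalIntegral.integral_neg] at h1
    simp only [Nat.succ_ne_zero, if_false] at h1
    simp only [← add_assoc]
    linarith

/-! ### Iterated primitives -/

/-- Iterated primitives of `g` with prescribed values at `a`. -/
def prim (a : ℝ) (g : ℝ → ℝ) (c : ℕ → ℝ) : ℕ → ℝ → ℝ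
  | 0 => g
  | m + 1 => fun s => c m + ∫ θ in a..s, prim a g c m θ

variable {g : ℝ → ℝ} {c : ℕ → ℝ}

/-- Integrability of `g` on the whole line, not only on `[a,b]`, makes the primitives behave well at
every real point, including `a` and `b`. -/
lemma intervalIntegrable_prim (hg : Integrable g) (m : ℕ) (x y : ℝ) :
    IntervalIntegrable (prim a g c m) volume x y := by
  induction m generalizing x y with
  | zero => exact hg.intervalIntegrable
  | succ m ih =>
    have : Continuous (prim a g c (m + 1)) :=
      continuous_const.add (intervalIntegral.continuous_primitive ih a)
    exact this.intervalIntegrable x y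

lemma continuous_prim (hg : Integrable g) (m : ℕ) : Continuous (prim a g c (m + 1)) :=
  continuous_const.add (intervalIntegral.continuous_primitive (intervalIntegrable_prim hg m) a)

/-- The constants count down from the highest order: `c m` becomes the value at `a` of the
derivative of order `k - 1 - m` of `prim a g c k`. This explains the index in `lift`. -/
lemma prim_left (m : ℕ) : prim a g c (m + 1) a = c m := by simp [prim]

/-- The fundamental theorem of calculus at every point needs a continuous integrand, so it starts
with the second primitive. The first one has derivative `g` only almost everywhere. -/
lemma hasDerivAt_prim (hg : Integrable g) (m : ℕ) (s : ℝ) :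
    HasDerivAt (prim a g c (m + 2)) (prim a g c (m + 1) s) s :=
  (((continuous_prim hg m).integral_hasStrictDerivAt a s).hasDerivAt).const_add _

lemma absolutelyContinuous_prim (hg : Integrable g) (m : ℕ) :
    AbsolutelyContinuousOnInterval (prim a g c (m + 1)) a b :=
  ((LipschitzWith.const (c m)).lipschitzOnWith.absolutelyContinuousOnInterval (K := 0)).add
    ((intervalIntegrable_prim hg m a b).absolutelyContinuousOnInterval_intervalIntegral
      left_mem_uIcc)

lemma iteratedDerivWithin_prim (hab : a < b) (hg : Integrable g) (j m : ℕ) :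
    EqOn (iteratedDerivWithin j (prim a g c (m + 1 + j)) (Icc a b)) (prim a g c (m + 1))
      (Icc a b) := by
  induction j with
  | zero => intro s _; simp
  | succ j ih =>
    intro s hs
    -- The innermost derivative is peeled off: it lowers the order of the primitive at every point
    -- of `[a,b]`, so the two iterated derivatives have equal arguments.
    rw [iteratedDerivWithin_succ', ← ih hs]
    refine iteratedDerivWithin_congr (fun x hx => ?_) hs
    have := hasDerivAt_prim (a := a) (c := c) hg (m + j) x
    rw [show m + 1 + (j + 1) = m + j + 2 by omega, show m + 1 + j = m + j + 1 by omega]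
    exact this.hasDerivWithinAt.derivWithin (uniqueDiffOn_Icc hab x hx)

lemma iteratedDerivWithin_prim_top (hab : a < b) (hg : Integrable g) (k : ℕ) :
    iteratedDerivWithin k (prim a g c k) (Icc a b) =ᵐ[leb a b] g := by
  cases k with
  | zero => simp [prim]
  | succ j =>
    have h1 : iteratedDerivWithin (j + 1) (prim a g c (j + 1)) (Icc a b) =ᵐ[leb a b]
        derivWithin (prim a g c 1) (Icc a b) := by
      filter_upwards [ae_mem_leb] with s hs
      rw [iteratedDerivWithin_succ]
      refine derivWithin_congr (fun x hx => ?_) ?_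
      · have := iteratedDerivWithin_prim (c := c) hab hg j 0 hx
        rwa [show 0 + 1 + j = j + 1 by omega] at this
      · have := iteratedDerivWithin_prim (c := c) hab hg j 0 hs
        rwa [show 0 + 1 + j = j + 1 by omega] at this
    -- Only the last derivative remains, that of the first primitive, and Lebesgue's differentiation
    -- theorem supplies it.
    refine (h1.trans (derivWithin_ae_eq_deriv _)).trans ?_
    refine ae_restrict_of_ae ?_
    filter_upwards [LocallyIntegrable.ae_hasDerivAt_integral hg.locallyIntegrable] with s hs
    exact ((hs a).const_add (c 0)).deriv

lemma memW_prim (hab : a < b) (hg : Integrable g) (hg2 : MemLp g 2 (leb a b)) (k : ℕ) :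
    MemW a b k (prim a g c k) := by
  refine ⟨fun j hj => ?_, fun j hj => ?_⟩
  · obtain ⟨m, rfl⟩ : ∃ m, k = m + 1 + j := ⟨k - j - 1, by omega⟩
    refine (absolutelyContinuous_prim (c := c) hg m).congr ?_
    rw [uIcc_of_le hab.le]
    exact (iteratedDerivWithin_prim hab hg j m).symm
  · rcases hj.lt_or_eq with h | rfl
    · obtain ⟨m, rfl⟩ : ∃ m, k = m + 1 + j := ⟨k - j - 1, by omega⟩
      refine (memLp_congr_ae ?_).1 ((continuous_prim (a := a) (c := c) hg m).memLp_leb 2)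
      filter_upwards [ae_mem_leb] with s hs
      exact (iteratedDerivWithin_prim hab hg j m hs).symm
    · exact (memLp_congr_ae (iteratedDerivWithin_prim_top hab hg j)).2 hg2

end Sobolev

/-! ### Stacked matrices and square integrability of matrix kernels -/

section Rows

variable {a b s t : ℝ} {κ l p q : Type} [Fintype κ] [Fintype l] [Fintype p] [Fintype q]

lemma integral_fromRows_mulVec {M : ℝ → Matrix κ q ℝ} {N : ℝ → Matrix l q ℝ} {f : ℝ → q → ℝ}
    (hM : IntervalIntegrable (fun θ => M θ *ᵥ f θ) volume s t)
    (hN : IntervalIntegrable (fun θ => N θ *ᵥ f θ) volume s t) :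
    ∫ θ in s..t, Matrix.fromRows (M θ) (N θ) *ᵥ f θ =
      Sum.elim (∫ θ in s..t, M θ *ᵥ f θ) (∫ θ in s..t, N θ *ᵥ f θ) := by
  have h : IntervalIntegrable (fun θ => Matrix.fromRows (M θ) (N θ) *ᵥ f θ) volume s t := by
    constructor
    all_goals
      refine Integrable.of_eval fun i => ?_
      rcases i with i | i
    · exact Integrable.eval hM.1 i
    · exact Integrable.eval hN.1 i
    · exact Integrable.eval hM.2 i
    · exact Integrable.eval hN.2 i
  ext i
  rw [eval_intervalIntegral h]
  rcases i with i | i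
  · rw [Sum.elim_inl, eval_intervalIntegral hM]; rfl
  · rw [Sum.elim_inr, eval_intervalIntegral hN]; rfl

lemma L2Mat.fromRows {M : ℝ → Matrix κ q ℝ} {N : ℝ → Matrix l q ℝ} (hM : L2Mat a b M)
    (hN : L2Mat a b N) : L2Mat a b fun θ => Matrix.fromRows (M θ) (N θ) := by
  rintro (i | i) j
  · exact hM i j
  · exact hN i j

lemma l2Mat_of_continuous {M : ℝ → Matrix p q ℝ} (hM : Continuous M) : L2Mat a b M :=
  fun i j => (hM.matrix_elem i j).memLp_leb 2

/-- Provides the square integrability of the integral term in `preBQ`, and so of `B_Q`. -/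
lemma l2Mat_matInt (hab : a ≤ b) {k : ℝ → Matrix κ p ℝ} {R : ℝ → ℝ → Matrix p q ℝ}
    (hk : L2Mat a b k) (hR : ∀ i j, GoodKer a b fun θ η => R θ η i j) :
    L2Mat a b fun η => matInt a b fun θ => k θ * R θ η := fun i j => by
  have hR2 : ∀ᵐ η ∂leb a b, ∀ i j, MemLp (fun θ => R θ η i j) 2 (leb a b) :=
    ae_all_iff.2 fun i => ae_all_iff.2 fun j => (hR i j).ae_memLp_left
  have h := memLp_finsetSum Finset.univ fun l (_ : l ∈ Finset.univ) =>
    (hR l j).memLp_integral (MemLp.integrable_leb (hk i l))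
  refine (memLp_congr_ae ?_).1 h
  filter_upwards [hR2] with η hη
  simp only [matInt, Matrix.of_apply, Matrix.mul_apply]
  rw [intervalIntegral_eq_leb hab, integral_finsetSum]
  exact fun l _ => (hk i l).integrable_mul (hη l j)

lemma goodKer_matrix_mul {M : ℝ → Matrix κ p ℝ} {N : ℝ → Matrix p q ℝ} (hM : Continuous M)
    (hN : L2Mat a b N) (i : κ) (j : q) : GoodKer a b fun s θ => (M s * N θ) i j := by
  simp only [Matrix.mul_apply]
  exact GoodKer.sum _ fun l => goodKer_mul (hM.matrix_elem i l) (hN l j)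

lemma FourPI.goodKer_kernel {K : FourPI κ l p q} (h₁ : ∀ i j, GoodKer a b fun s θ => K.R₁ s θ i j)
    (h₂ : ∀ i j, GoodKer a b fun s θ => K.R₂ s θ i j) (i : p) (j : q) :
    GoodKer a b fun s θ => K.kernel s θ i j := by
  have : (fun s θ => K.kernel s θ i j) = fun s θ => if θ ≤ s then K.R₁ s θ i j
      else K.R₂ s θ i j := by
    funext s θ; unfold kernel; split_ifs <;> rfl
  rw [this]
  exact (h₁ i j).ite (h₂ i j)

end Rows

/-! ### Reconstruction of the state from its highest derivatives -/

section State

variable {N : ℕ} {n : Fin (N + 1) → ℕ} {nBC nv : ℕ} {a b s : ℝ}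

/-- `𝒟 x̂`: the derivatives of the highest order. -/
def topDerivs (a b : ℝ) (x : ℝ → StateIdx n → ℝ) (s : ℝ) : StateIdx n → ℝ :=
  fun c => iteratedDerivWithin c.1.val (fun σ => x σ c) (Icc a b) s

lemma MemWn.l2Vec {x : ℝ → StateIdx n → ℝ} (hx : MemWn a b x) : L2Vec a b (topDerivs a b x) :=
  fun c => (hx c).2 _ le_rfl

lemma Tmat_mulVec (r : ℝ) (v : CIdx n → ℝ) (c : StateIdx n) (j : Fin c.1.val) :
    (Tmat n r *ᵥ v) ⟨c, j⟩ = ∑ j' : Fin c.1.val,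
      if j.val ≤ j'.val then tau (j'.val - j.val) r * v ⟨c, j'⟩ else 0 := by
  simp only [Matrix.mulVec, dotProduct, Tmat, Matrix.of_apply, Fintype.sum_sigma (ι := StateIdx n)]
  rw [Finset.sum_eq_single c]
  · simp
  · intro c' _ hc
    exact Finset.sum_eq_zero fun j' _ => by simp [hc.symm]
  · simp

lemma Qmat_mulVec (r : ℝ) (v : StateIdx n → ℝ) (c : StateIdx n) (j : Fin c.1.val) :
    (Qmat n r *ᵥ v) ⟨c, j⟩ = tau (c.1.val - j.val - 1) r * v c := by
  simp [Matrix.mulVec, dotProduct, Qmat]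

lemma continuous_Tmat : Continuous (Tmat n) := by
  refine continuous_matrix fun p p' => ?_
  simp only [Tmat, Matrix.of_apply]
  split_ifs
  · exact continuous_tau _
  · exact continuous_const

lemma continuous_Qmat : Continuous (Qmat n) := by
  refine continuous_matrix fun p p' => ?_
  simp only [Qmat, Matrix.of_apply]
  split_ifs
  · exact continuous_tau _
  · exact continuous_const

/-- `𝒞 x̂` is determined by its value at `a` and by `𝒟 x̂`. -/
theorem contDerivs_eq {x : ℝ → StateIdx n → ℝ} (hx : MemWn a b x) (hs : s ∈ Icc a b) :
    contDerivs a b x s = Tmat n (s - a) *ᵥ contDerivs a b x a +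
      ∫ θ in a..s, Qmat n (s - θ) *ᵥ topDerivs a b x θ := by
  have hab := hs.1.trans hs.2
  have hi : IntervalIntegrable (fun θ => Qmat n (s - θ) *ᵥ topDerivs a b x θ) volume a s :=
    intervalIntegrable_of_mem ((l2Mat_of_continuous (continuous_Qmat.comp
      (continuous_const.sub continuous_id))).mulVec_integrable hx.l2Vec) (left_mem_Icc.2 hab) hs
  ext ⟨c, j⟩
  obtain ⟨m, hm⟩ : ∃ m, c.1.val = j.val + (m + 1) :=
    ⟨c.1.val - j.val - 1, by have := j.isLt; omega⟩
  have h := (hx c).taylor hs j.val m (by omega)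
  rw [Pi.add_apply, eval_intervalIntegral hi, Tmat_mulVec]
  simp only [Qmat_mulVec]
  rw [show c.1.val - j.val - 1 = m by omega]
  simp only [contDerivs, topDerivs]
  -- The row of `T` at order `j` has no entries at orders below `j`; the remaining `m + 1` terms,
  -- shifted by `j`, are the Taylor sum.
  rw [Fin.sum_univ_eq_sum_range (fun j' => if j.val ≤ j' then tau (j' - j.val) (s - a) *
    iteratedDerivWithin j' (fun σ => x σ c) (Icc a b) a else 0) c.1.val,
    show Finset.range c.1.val = Finset.range (j.val + (m + 1)) by rw [← hm],
    Finset.sum_range_add, Finset.sum_eq_zero, zero_add]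
  · simp only [le_add_iff_nonneg_right, zero_le, if_true, Nat.add_sub_cancel_left]
    rw [h, show j.val + m + 1 = c.1.val by omega]
  · intro j' hj'
    rw [if_neg]
    simpa using hj'

lemma allDerivs_eq (x : ℝ → StateIdx n → ℝ) (s : ℝ) :
    allDerivs a b x s = U1mat n *ᵥ topDerivs a b x s + U2mat n *ᵥ contDerivs a b x s := by
  ext ⟨c, j⟩
  have h1 : (U1mat n *ᵥ topDerivs a b x s) ⟨c, j⟩ =
      if j.val = c.1.val then topDerivs a b x s c else 0 := by
    simp only [Matrix.mulVec, dotProduct, U1mat, Matrix.of_apply]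
    rw [Finset.sum_eq_single c]
    · simp
    · intro c' _ hc
      simp [hc.symm]
    · simp
  have h2 : (U2mat n *ᵥ contDerivs a b x s) ⟨c, j⟩ =
      if h : j.val < c.1.val then contDerivs a b x s ⟨c, ⟨j.val, h⟩⟩ else 0 := by
    simp only [Matrix.mulVec, dotProduct, U2mat, Matrix.of_apply,
      Fintype.sum_sigma (ι := StateIdx n)]
    rw [Finset.sum_eq_single c]
    · split_ifs with h
      · rw [Finset.sum_eq_single ⟨j.val, h⟩]
        · simp
        · intro j' _ hj
          have : j.val ≠ j'.val := fun e => hj (Fin.ext e.symm)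
          simp [this]
        · simp
      · refine Finset.sum_eq_zero fun j' _ => ?_
        have : j.val ≠ j'.val := by have := j'.isLt; omega
        simp [this]
    · intro c' _ hc
      exact Finset.sum_eq_zero fun j' _ => by simp [hc.symm]
    · simp
  rw [Pi.add_apply, h1, h2]
  have hj := j.isLt
  by_cases h : j.val = c.1.val
  · simp [allDerivs, topDerivs, h]
  · have : j.val < c.1.val := by omega
    simp [allDerivs, contDerivs, h, this]

/-! ### Boundary conditions -/

/-- The operator that maps `((𝒞 x̂)(a), 𝒟 x̂)` to `((𝒞 x̂)(a), ℱ x̂)`. -/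
def recon (n : Fin (N + 1) → ℕ) (a : ℝ) : FourPI (CIdx n) (CIdx n) (FIdx n) (StateIdx n) where
  P := 1
  Q₁ _ := 0
  Q₂ s := U2mat n * Tmat n (s - a)
  R₀ _ := U1mat n
  R₁ s θ := U2mat n * Qmat n (s - θ)
  R₂ _ _ := 0

lemma goodKer_const_mul_Qmat {κ : Type} (E : Matrix κ (CIdx n) ℝ) (i : κ) (j : StateIdx n) :
    GoodKer a b fun s θ => (E * Qmat n (s - θ)) i j := by
  refine goodKer_of_continuous ?_
  have : Continuous fun z : ℝ × ℝ => E * Qmat n (z.1 - z.2) :=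
    continuous_const.matrix_mul (continuous_Qmat.comp (continuous_fst.sub continuous_snd))
  exact this.matrix_elem i j

lemma continuous_const_mul_Tmat {κ : Type} (E : Matrix κ (CIdx n) ℝ) (a : ℝ) :
    Continuous fun s => E * Tmat n (s - a) :=
  continuous_const.matrix_mul (continuous_Tmat.comp (continuous_id.sub continuous_const))

lemma regular_recon : (recon n a).Regular a b where
  Q₁ _ _ := memLp_const 0
  Q₂ := l2Mat_of_continuous (continuous_const_mul_Tmat _ a)
  R₀ _ _ := memLp_const _
  goodKer := FourPI.goodKer_kernel (goodKer_const_mul_Qmat _)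
    fun _ _ => goodKer_of_continuous continuous_const

lemma allDerivs_eq_recon {x : ℝ → StateIdx n → ℝ} (hx : MemWn a b x) (hs : s ∈ Icc a b) :
    allDerivs a b x s = (recon n a).fn a b (contDerivs a b x a) (topDerivs a b x) s := by
  have hab := hs.1.trans hs.2
  have hi : IntervalIntegrable (fun θ => Qmat n (s - θ) *ᵥ topDerivs a b x θ) volume a s :=
    intervalIntegrable_of_mem ((l2Mat_of_continuous (continuous_Qmat.comp
      (continuous_const.sub continuous_id))).mulVec_integrable hx.l2Vec) (left_mem_Icc.2 hab) hs
  rw [allDerivs_eq, contDerivs_eq hx hs, FourPI.fn, Matrix.mulVec_add,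
    mulVec_intervalIntegral _ hi]
  simp only [recon, Matrix.mulVec_mulVec, Matrix.zero_mulVec, intervalIntegral.integral_zero]
  abel

variable {Gb : BCParams n nBC nv}

lemma BTinv_mul (h : Admissible a b Gb) : BTinv a b Gb * BT a b Gb = 1 := by
  rw [BTinv, dif_pos h]; exact h.choose_spec.1

lemma mul_BTinv (h : Admissible a b Gb) : BT a b Gb * BTinv a b Gb = 1 := by
  rw [BTinv, dif_pos h]; exact h.choose_spec.2

/-- `B_T B_Q`. -/
def preBQ (b : ℝ) (Gb : BCParams n nBC nv) (s : ℝ) : Matrix (Fin nBC) (StateIdx n) ℝ :=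
  Gb.BI s * U1mat n + (matInt s b fun θ => Gb.BI θ * U2mat n * Qmat n (θ - s))
    - Gb.B * Matrix.fromRows (0 : Matrix (CIdx n) (StateIdx n) ℝ) (Qmat n (b - s))

/-- The integral over `[a,b]` shrinks to `[η,b]` because Taylor's remainder at `θ` sees only the
values of `𝒟 x̂` at `η ≤ θ`. This is how the inner integral of `B_Q` arises. -/
lemma ae_matInt_recon (hGb : Gb.Regular a b) : ∀ᵐ η ∂leb a b,
    (matInt a b fun θ => Gb.BI θ * (recon n a).kernel θ η) =
      matInt η b fun θ => Gb.BI θ * U2mat n * Qmat n (θ - η) := by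
  filter_upwards [regular_recon.matInt_kernel hGb] with η hη
  rw [hη]
  simp only [recon, Matrix.mul_zero, ← Matrix.mul_assoc]
  convert zero_add _
  ext; simp [matInt]

lemma l2Mat_fromRows_Qmat :
    L2Mat a b fun s => Matrix.fromRows (0 : Matrix (CIdx n) (StateIdx n) ℝ) (Qmat n (b - s)) :=
  L2Mat.fromRows (fun _ _ => memLp_const 0)
    (l2Mat_of_continuous (continuous_Qmat.comp (continuous_const.sub continuous_id)))

lemma l2Mat_preBQ (hab : a ≤ b) (hGb : Gb.Regular a b) : L2Mat a b (preBQ b Gb) := by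
  refine L2Mat.sub (L2Mat.add (L2Mat.mul_const hGb _) ?_) (l2Mat_fromRows_Qmat.const_mul _)
  intro i j
  refine (memLp_congr_ae ?_).1 (l2Mat_matInt hab hGb (regular_recon (a := a)).goodKer i j)
  filter_upwards [ae_matInt_recon hGb] with η hη
  rw [hη]

/-- No boundedness can be expected, as `B_I` itself is only square integrable. This is why `GoodKer`
asks for domination by an `L₂` function of the second variable instead of a constant. -/
lemma l2Mat_BQ (hab : a ≤ b) (hGb : Gb.Regular a b) : L2Mat a b (BQ a b Gb) :=
  (l2Mat_preBQ hab hGb).const_mul _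

lemma bdryValues_eq (hab : a ≤ b) {x : ℝ → StateIdx n → ℝ} (hx : MemWn a b x) :
    bdryValues a b x = Matrix.fromRows (Tmat n 0) (Tmat n (b - a)) *ᵥ contDerivs a b x a +
      ∫ θ in a..b, Matrix.fromRows (0 : Matrix (CIdx n) (StateIdx n) ℝ) (Qmat n (b - θ)) *ᵥ
        topDerivs a b x θ := by
  have ha := left_mem_Icc.2 hab
  have hb := right_mem_Icc.2 hab
  have h0 := contDerivs_eq hx ha
  rw [sub_self, intervalIntegral.integral_same, add_zero] at h0
  rw [integral_fromRows_mulVec, Matrix.fromRows_mulVec, ← h0, bdryValues]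
  · conv_lhs => rw [contDerivs_eq hx hb]
    ext (i | i) <;> simp
  · simp
  · exact intervalIntegrable_of_mem ((l2Mat_of_continuous (continuous_Qmat.comp
      (continuous_const.sub continuous_id))).mulVec_integrable hx.l2Vec) ha hb

/-- The boundary conditions determine `(𝒞 x̂)(a)`. -/
def bcInit (a b : ℝ) (Gb : BCParams n nBC nv) (v : Fin nv → ℝ) (f : ℝ → StateIdx n → ℝ) :
    CIdx n → ℝ :=
  (BTinv a b Gb * Gb.Bv) *ᵥ v + ∫ θ in a..b, BQ a b Gb θ *ᵥ f θ

/-- By Taylor's formula and Fubini's theorem the boundary conditions turn into `B_T c = B_v v + ∫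
preBQ f` for `c = (𝒞 x̂)(a)` and `f = 𝒟 x̂`. The left inverse of `B_T` yields the formula for `c`,
and the right inverse shows that this `c` satisfies the conditions. -/
theorem mem_Xset_iff (hab : a ≤ b) (hGb : Gb.Regular a b) (hadm : Admissible a b Gb)
    {x : ℝ → StateIdx n → ℝ} (hx : MemWn a b x) (v : Fin nv → ℝ) :
    x ∈ Xset a b Gb v ↔ contDerivs a b x a = bcInit a b Gb v (topDerivs a b x) := by
  have ha := left_mem_Icc.2 hab
  have hb := right_mem_Icc.2 hab
  set c := contDerivs a b x a with hc
  set f := topDerivs a b x with hf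
  have hfL : L2Vec a b f := hx.l2Vec
  obtain ⟨h1, h2, h3⟩ := regular_recon.row_comp hab hGb c hfL
  have hBI : ∫ s in a..b, Gb.BI s *ᵥ allDerivs a b x s =
      ∫ s in a..b, Gb.BI s *ᵥ (recon n a).fn a b c f s :=
    intervalIntegral_congr_leb (ae_mem_leb.mono fun s hs => by
      simp only [allDerivs_eq_recon hx hs, hc, hf]) ha hb
  have hpre : IntervalIntegrable (fun η => preBQ b Gb η *ᵥ f η) volume a b :=
    intervalIntegrable_of_mem ((l2Mat_preBQ hab hGb).mulVec_integrable hfL) ha hb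
  have hrow : IntervalIntegrable (fun η =>
      Matrix.fromRows (0 : Matrix (CIdx n) (StateIdx n) ℝ) (Qmat n (b - η)) *ᵥ f η) volume a b :=
    intervalIntegrable_of_mem (l2Mat_fromRows_Qmat.mulVec_integrable hfL) ha hb
  have hint : ∫ η in a..b, preBQ b Gb η *ᵥ f η =
      (∫ η in a..b, (Gb.BI η * (recon n a).R₀ η +
        matInt a b fun θ => Gb.BI θ * (recon n a).kernel θ η) *ᵥ f η) -
      ∫ η in a..b, Gb.B *ᵥ (Matrix.fromRows (0 : Matrix (CIdx n) (StateIdx n) ℝ)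
        (Qmat n (b - η)) *ᵥ f η) := by
    rw [← intervalIntegral.integral_sub (intervalIntegrable_of_mem h3 ha hb)
      (intervalIntegrable_const_mulVec _ hrow)]
    refine intervalIntegral_congr_leb ?_ ha hb
    filter_upwards [ae_matInt_recon hGb] with η hη
    rw [hη, Matrix.mulVec_mulVec, ← Matrix.sub_mulVec]
    rfl
  have key : (∫ s in a..b, Gb.BI s *ᵥ allDerivs a b x s) +
      (Gb.Bv *ᵥ v - Gb.B *ᵥ bdryValues a b x) =
      (Gb.Bv *ᵥ v + ∫ η in a..b, preBQ b Gb η *ᵥ f η) - BT a b Gb *ᵥ c := by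
    rw [hBI, h1, bdryValues_eq hab hx, hint, BT, Matrix.mulVec_add, Matrix.sub_mulVec,
      mulVec_intervalIntegral _ hrow, Matrix.mulVec_mulVec]
    simp only [recon, ← Matrix.mul_assoc]
    abel
  have hBQ : ∫ θ in a..b, BQ a b Gb θ *ᵥ f θ =
      BTinv a b Gb *ᵥ ∫ θ in a..b, preBQ b Gb θ *ᵥ f θ := by
    rw [mulVec_intervalIntegral _ hpre]
    simp only [Matrix.mulVec_mulVec]
    rfl
  rw [bcInit, hBQ, ← Matrix.mulVec_mulVec, ← Matrix.mulVec_add]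
  constructor
  · intro h
    have h' := h.2
    rw [key, sub_eq_zero] at h'
    rw [h', Matrix.mulVec_mulVec, BTinv_mul hadm, Matrix.one_mulVec]
  · intro h
    refine ⟨hx, ?_⟩
    rw [key, h, Matrix.mulVec_mulVec, mul_BTinv hadm, Matrix.one_mulVec, sub_self]

/-- Common form of the reconstruction of `x̂` and of its derivatives. -/
theorem reconstruct {κ : Type} [Fintype κ] (hGb : Gb.Regular a b)
    (hadm : Admissible a b Gb) {x : ℝ → StateIdx n → ℝ} {v : Fin nv → ℝ}
    (hx : x ∈ Xset a b Gb v) (E : Matrix κ (CIdx n) ℝ) (G : Matrix κ (StateIdx n) ℝ)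
    (hs : s ∈ Icc a b) :
    (E * Tmat n (s - a) * BTinv a b Gb * Gb.Bv) *ᵥ v + (G *ᵥ topDerivs a b x s +
      (∫ θ in a..s, (E * Tmat n (s - a) * BQ a b Gb θ + E * Qmat n (s - θ)) *ᵥ topDerivs a b x θ) +
      ∫ θ in s..b, (E * Tmat n (s - a) * BQ a b Gb θ) *ᵥ topDerivs a b x θ) =
    E *ᵥ contDerivs a b x s + G *ᵥ topDerivs a b x s := by
  have hab := hs.1.trans hs.2
  have ha := left_mem_Icc.2 hab
  have hb := right_mem_Icc.2 hab
  have hfL : L2Vec a b (topDerivs a b x) := hx.1.l2Vec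
  have hQ : L2Mat a b fun θ => Qmat n (s - θ) :=
    l2Mat_of_continuous (continuous_Qmat.comp (continuous_const.sub continuous_id))
  have i1 := ((l2Mat_BQ hab hGb).const_mul (E * Tmat n (s - a))).mulVec_integrable hfL
  have i2 := (hQ.const_mul E).mulVec_integrable hfL
  have hc := (mem_Xset_iff hab hGb hadm hx.1 v).1 hx
  have hi := intervalIntegrable_of_mem ((l2Mat_BQ hab hGb).mulVec_integrable hfL) ha hb
  simp only [Matrix.add_mulVec]
  rw [intervalIntegral.integral_add (intervalIntegrable_of_mem i1 ha hs)
    (intervalIntegrable_of_mem i2 ha hs), contDerivs_eq hx.1 hs, hc, bcInit]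
  -- The `B_Q` terms on `[a,s]` and `[s,b]` add up to an integral over `[a,b]`, which is the
  -- contribution of `𝒟 x̂` to `(𝒞 x̂)(a)`; the `Q` term on `[a,s]` is Taylor's remainder.
  have e1 := intervalIntegral.integral_add_adjacent_intervals
    (intervalIntegrable_of_mem i1 ha hs) (intervalIntegrable_of_mem i1 hs hb)
  have e2 : ∫ θ in a..b, (E * Tmat n (s - a) * BQ a b Gb θ) *ᵥ topDerivs a b x θ =
      E *ᵥ Tmat n (s - a) *ᵥ ∫ θ in a..b, BQ a b Gb θ *ᵥ topDerivs a b x θ := by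
    rw [Matrix.mulVec_mulVec, mulVec_intervalIntegral _ hi]
    simp only [Matrix.mulVec_mulVec]
  have e3 : ∫ θ in a..s, (E * Qmat n (s - θ)) *ᵥ topDerivs a b x θ =
      E *ᵥ ∫ θ in a..s, Qmat n (s - θ) *ᵥ topDerivs a b x θ := by
    rw [mulVec_intervalIntegral _ (intervalIntegrable_of_mem (hQ.mulVec_integrable hfL) ha hs)]
    simp only [Matrix.mulVec_mulVec]
  rw [Matrix.mulVec_add, Matrix.mulVec_add, Matrix.mulVec_add, ← e2, ← e1, e3,
    Matrix.mulVec_mulVec, Matrix.mulVec_mulVec, ← Matrix.mul_assoc]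
  abel

/-! ### The operator `Υ` -/

lemma regular_Upsilon (hab : a ≤ b) (hGb : Gb.Regular a b) : (Upsilon a b Gb).Regular a b where
  Q₁ := L2Mat.fromRows (fun _ _ => memLp_const 0) (L2Mat.fromRows (l2Mat_BQ hab hGb)
    (((l2Mat_BQ hab hGb).const_mul _).add
      (l2Mat_of_continuous (continuous_Qmat.comp (continuous_const.sub continuous_id)))))
  Q₂ := ((l2Mat_of_continuous (continuous_const_mul_Tmat _ a)).mul_const _).mul_const _
  R₀ _ _ := memLp_const _
  goodKer := FourPI.goodKer_kernel
    (fun i j => (goodKer_matrix_mul (continuous_const_mul_Tmat _ a) (l2Mat_BQ hab hGb) i j).add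
      (goodKer_const_mul_Qmat _ i j))
    fun i j => goodKer_matrix_mul (continuous_const_mul_Tmat _ a) (l2Mat_BQ hab hGb) i j

lemma Upsilon_fn (hGb : Gb.Regular a b) (hadm : Admissible a b Gb)
    {x : ℝ → StateIdx n → ℝ} {v : Fin nv → ℝ} (hx : x ∈ Xset a b Gb v) (hs : s ∈ Icc a b) :
    (Upsilon a b Gb).fn a b v (topDerivs a b x) s = allDerivs a b x s := by
  rw [allDerivs_eq, add_comm (U1mat n *ᵥ _), ← reconstruct hGb hadm hx (U2mat n) (U1mat n) hs]
  rfl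

lemma Upsilon_fin (hab : a ≤ b) (hGb : Gb.Regular a b) (hadm : Admissible a b Gb)
    {x : ℝ → StateIdx n → ℝ} {v : Fin nv → ℝ} (hx : x ∈ Xset a b Gb v) :
    (Upsilon a b Gb).fin a b v (topDerivs a b x) = Sum.elim v (bdryValues a b x) := by
  have ha := left_mem_Icc.2 hab
  have hb := right_mem_Icc.2 hab
  have hfL : L2Vec a b (topDerivs a b x) := hx.1.l2Vec
  have hc := (mem_Xset_iff hab hGb hadm hx.1 v).1 hx
  have J {κ : Type} [Fintype κ] {M : ℝ → Matrix κ (StateIdx n) ℝ} (hM : L2Mat a b M) :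
      IntervalIntegrable (fun θ => M θ *ᵥ topDerivs a b x θ) volume a b :=
    intervalIntegrable_of_mem (hM.mulVec_integrable hfL) ha hb
  have hQ : L2Mat a b fun θ => Qmat n (b - θ) :=
    l2Mat_of_continuous (continuous_Qmat.comp (continuous_const.sub continuous_id))
  have h1 := l2Mat_BQ hab hGb
  have h2 := h1.const_mul (Tmat n (b - a))
  have e2 : ∫ θ in a..b, (Tmat n (b - a) * BQ a b Gb θ) *ᵥ topDerivs a b x θ =
      Tmat n (b - a) *ᵥ ∫ θ in a..b, BQ a b Gb θ *ᵥ topDerivs a b x θ := by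
    rw [mulVec_intervalIntegral _ (J h1)]
    simp only [Matrix.mulVec_mulVec]
  have hcb : contDerivs a b x b = (Tmat n (b - a) * BTinv a b Gb * Gb.Bv) *ᵥ v +
      ∫ θ in a..b, (Tmat n (b - a) * BQ a b Gb θ + Qmat n (b - θ)) *ᵥ topDerivs a b x θ := by
    simp only [Matrix.add_mulVec]
    rw [intervalIntegral.integral_add (J h2) (J hQ), e2, contDerivs_eq hx.1 hb, hc, bcInit,
      Matrix.mulVec_add, Matrix.mulVec_mulVec, Matrix.mul_assoc, add_assoc]
  rw [FourPI.fin]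
  simp only [Upsilon]
  rw [integral_fromRows_mulVec (by simp) (J (h1.fromRows (h2.add hQ))),
    integral_fromRows_mulVec (J h1) (J (h2.add hQ)), Matrix.fromRows_mulVec,
    Matrix.fromRows_mulVec, bdryValues, hcb, hc, bcInit]
  ext (i | i | i) <;> simp

/-! ### The operator `𝒯` -/

/-- The matrix that selects the derivatives of order zero from `𝒞 x̂`. -/
def orderZero (n : Fin (N + 1) → ℕ) : Matrix (StateIdx n) (CIdx n) ℝ := firstRows n 1

lemma firstRows_eq {κ : Type} (M : Matrix (CIdx n) κ ℝ) : firstRows n M = orderZero n * M := by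
  ext c k
  rw [Matrix.mul_apply]
  simp only [orderZero, firstRows, Matrix.of_apply]
  split_ifs with h
  · simp [Matrix.one_apply]
  · simp

/-- A component of the block `x̂₀` is its own highest derivative and is restored by `G₀`; every
other component is the entry of order zero in `𝒞 x̂`. -/
lemma state_eq (x : ℝ → StateIdx n → ℝ) (s : ℝ) :
    orderZero n *ᵥ contDerivs a b x s + G0 n *ᵥ topDerivs a b x s = x s := by
  ext c
  have h1 : (orderZero n *ᵥ contDerivs a b x s) c =
      if h : 0 < c.1.val then contDerivs a b x s ⟨c, ⟨0, h⟩⟩ else 0 := by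
    simp only [Matrix.mulVec, dotProduct, orderZero, firstRows, Matrix.of_apply]
    split_ifs with h
    · simp [Matrix.one_apply]
    · simp
  rw [Pi.add_apply, h1, G0, Matrix.mulVec_diagonal]
  by_cases h : c.1.val = 0
  · simp [h, topDerivs]
  · have : 0 < c.1.val := Nat.pos_of_ne_zero h
    simp [h, this, contDerivs]

/-- The case `E = orderZero n`, `G = G0 n` of `reconstruct`: on states that satisfy the boundary
conditions, `𝒯` undoes the passage from `x̂` to `𝒟 x̂`. -/
lemma assocPIE_T_fn {nx nw nu nr nz ny : ℕ} (Go : ODEParams nx nw nu nr nz ny nv)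
    (Gp : PDEParams n nv nr) (hGb : Gb.Regular a b)
    (hadm : Admissible a b Gb) {x₀ : Fin nx → ℝ} {x : ℝ → StateIdx n → ℝ}
    (hx : x ∈ Xset a b Gb (Go.Cv *ᵥ x₀)) (hs : s ∈ Icc a b) :
    (assocPIE a b Go Gb Gp).T.fn a b x₀ (topDerivs a b x) s = x s := by
  conv_rhs => rw [← state_eq (a := a) (b := b) x s]
  rw [← reconstruct hGb hadm hx _ _ hs, FourPI.fn]
  simp only [assocPIE, G1, G2, Gv]
  rw [← Matrix.mulVec_mulVec, firstRows_eq (_ * _ * _)]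
  have e (θ : ℝ) : orderZero n * Qmat n (s - θ) + orderZero n * (Tmat n (s - a) * BQ a b Gb θ) =
      orderZero n * (Tmat n (s - a) * BQ a b Gb θ) + orderZero n * Qmat n (s - θ) :=
    add_comm _ _
  simp only [firstRows_eq (Tmat n (s - a) * BQ a b Gb _), firstRows_eq (Qmat n _),
    Matrix.mul_assoc, e]

end State

/-! ### Norms, bounds and differentiation in `L₂` and `ℝL₂` -/

section L2

variable {a b s t : ℝ} {m p q ι : Type} [Fintype m] [Fintype p] [Fintype q] [Fintype ι]

/-- Square integrability is an almost everywhere property, so otherwise both sides take the default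
value `0`. Thus right-hand sides of the two equations can be compared without proving that they are
square integrable. -/
lemma ofFun_congr {f g : ℝ → ι → ℝ} (h : f =ᵐ[leb a b] g) : ofFun a b f = ofFun a b g := by
  have h' : (fun s => (WithLp.toLp 2 (f s) : EuclideanSpace ℝ ι)) =ᵐ[leb a b]
      fun s => WithLp.toLp 2 (g s) := h.mono fun s hs => by simp only [hs]
  by_cases hf : MemLp (fun s => (WithLp.toLp 2 (f s) : EuclideanSpace ℝ ι)) 2 (leb a b)
  · have hg := (memLp_congr_ae h').1 hf
    rw [ofFun, ofFun, dif_pos hf, dif_pos hg, MemLp.toLp_eq_toLp_iff]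
    exact h'
  · have hg := fun h => hf ((memLp_congr_ae h').2 h)
    rw [ofFun, ofFun, dif_neg hf, dif_neg hg]

lemma ofFun_zero : ofFun a b (fun _ => (0 : ι → ℝ)) = 0 := by
  have h : MemLp (fun _ : ℝ => (WithLp.toLp 2 (0 : ι → ℝ) : EuclideanSpace ℝ ι)) 2 (leb a b) :=
    memLp_const _
  rw [ofFun, dif_pos h]
  exact MemLp.toLp_zero h

lemma L2Vec.memLp {f : ℝ → ι → ℝ} (hf : L2Vec a b f) :
    MemLp (fun s => (WithLp.toLp 2 (f s) : EuclideanSpace ℝ ι)) 2 (leb a b) :=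
  MemLp.of_eval_piLp hf

lemma ofFun_coe_ae {f : ℝ → ι → ℝ} (hf : L2Vec a b f) :
    (fun s => (ofFun a b f s).ofLp) =ᵐ[leb a b] f := by
  rw [ofFun, dif_pos hf.memLp]
  filter_upwards [hf.memLp.coeFn_toLp] with s hs
  rw [hs]

lemma l2Vec_coe (F : L2Space a b ι) : L2Vec a b fun s => (F s).ofLp :=
  fun j => (Lp.memLp F).eval_piLp j

lemma ofFun_coe (F : L2Space a b ι) : ofFun a b (fun s => (F s).ofLp) = F := by
  rw [ofFun, dif_pos (l2Vec_coe F).memLp]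
  exact Lp.toLp_coeFn F _

lemma norm_ofFun_sq (hab : a ≤ b) {f : ℝ → ι → ℝ} (hf : L2Vec a b f) :
    ‖ofFun a b f‖ ^ 2 = ∑ c, ∫ s in a..b, f s c ^ 2 := by
  rw [← real_inner_self_eq_norm_sq, L2.inner_def]
  have h : (fun s => inner ℝ (ofFun a b f s) (ofFun a b f s)) =ᵐ[leb a b]
      fun s => ∑ c, f s c ^ 2 := by
    filter_upwards [ofFun_coe_ae hf] with s hs
    rw [real_inner_self_eq_norm_sq, EuclideanSpace.norm_sq_eq]
    simp only [hs, Real.norm_eq_abs, sq_abs]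
  rw [integral_congr_ae h, integral_finsetSum _ fun c _ => (hf c).integrable_sq]
  simp only [intervalIntegral_eq_leb hab]

/-- The Cauchy–Schwarz inequality for the scalar `L₂` functions `|h|` and `‖F‖`. -/
lemma integral_mul_norm_le {h : ℝ → ℝ} (hh : MemLp h 2 (leb a b)) (F : L2Space a b ι) :
    Integrable (fun s => |h s| * ‖F s‖) (leb a b) ∧
    ∫ s, |h s| * ‖F s‖ ∂leb a b ≤ ‖hh.abs.toLp _‖ * ‖F‖ := by
  have hF := (Lp.memLp F).norm
  refine ⟨hh.abs.integrable_mul hF, ?_⟩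
  have e : ‖hF.toLp _‖ = ‖F‖ := by
    rw [Lp.norm_toLp, eLpNorm_norm, Lp.norm_def]
  rw [← e]
  refine le_trans (le_of_eq ?_) (real_inner_le_norm (hh.abs.toLp _) (hF.toLp _))
  rw [L2.inner_def]
  refine integral_congr_ae ?_
  filter_upwards [hh.abs.coeFn_toLp, hF.coeFn_toLp] with s h1 h2
  rw [h1, h2]
  simp [mul_comm]

lemma mulVec_norm_le {A : Matrix m p ℝ} {C : ℝ} (hC : 0 ≤ C) (hA : ∀ i j, |A i j| ≤ C)
    (v : p → ℝ) : ‖A *ᵥ v‖ ≤ C * Fintype.card p * ‖v‖ := by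
  rw [pi_norm_le_iff_of_nonneg (by positivity)]
  intro i
  simp only [Matrix.mulVec, dotProduct]
  refine (norm_sum_le _ _).trans ?_
  refine (Finset.sum_le_sum (g := fun _ => C * ‖v‖) fun j _ => ?_).trans (le_of_eq ?_)
  · rw [norm_mul]
    exact mul_le_mul (hA i j) (norm_le_pi_norm v j) (norm_nonneg _) hC
  · simp only [Finset.sum_const, Finset.card_univ, nsmul_eq_mul]
    ring

lemma norm_le_norm_toLp (v : p → ℝ) : ‖v‖ ≤ ‖(WithLp.toLp 2 v : EuclideanSpace ℝ p)‖ :=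
  (pi_norm_le_iff_of_nonneg (norm_nonneg _)).2 fun i =>
    PiLp.norm_apply_le (WithLp.toLp 2 v : EuclideanSpace ℝ p) i

/-- The integral of a matrix function dominated by a fixed square integrable function against an
`L₂` function is bounded by the `L₂` norm. -/
lemma exists_integral_mulVec_bound {h : ℝ → ℝ} (hh : MemLp h 2 (leb a b)) :
    ∃ C : ℝ, 0 ≤ C ∧ ∀ (M : ℝ → Matrix m p ℝ), (∀ θ ∈ Icc a b, ∀ i j, |M θ i j| ≤ |h θ|) →
      ∀ f : ℝ → p → ℝ, L2Vec a b f → ∀ s ∈ Icc a b, ∀ t ∈ Icc a b,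
        ‖∫ θ in s..t, M θ *ᵥ f θ‖ ≤ C * ‖ofFun a b f‖ := by
  -- The factor `card p` comes from bounding a matrix by its entries in the supremum norm, the other
  -- from the Cauchy–Schwarz inequality. Since `M` enters only through `h`, the constant also serves
  -- families of kernels such as `Q(s - ·)`.
  refine ⟨Fintype.card p * ‖hh.abs.toLp _‖, by positivity, fun M hM f hf s hs t ht => ?_⟩
  obtain ⟨h1, h2⟩ := integral_mul_norm_le hh (ofFun a b f)
  have hsub : uIoc s t ⊆ Icc a b := uIoc_subset_uIcc.trans (uIcc_subset_Icc hs ht)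
  rw [intervalIntegral.norm_intervalIntegral_eq]
  have h3 := h1.const_mul (Fintype.card p : ℝ)
  calc ‖∫ θ in uIoc s t, M θ *ᵥ f θ‖
      ≤ ∫ θ in uIoc s t, Fintype.card p * (|h θ| * ‖ofFun a b f θ‖) := by
        refine norm_integral_le_of_norm_le (h3.mono_measure (Measure.restrict_mono hsub le_rfl)) ?_
        have hcoe := ae_mono (Measure.restrict_mono hsub le_rfl) (ofFun_coe_ae hf)
        filter_upwards [hcoe, ae_restrict_mem measurableSet_uIoc] with θ hθ hm
        refine (mulVec_norm_le (abs_nonneg _) (hM θ (hsub hm)) (f θ)).trans ?_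
        have : ‖f θ‖ ≤ ‖ofFun a b f θ‖ := by
          rw [← hθ]
          exact norm_le_norm_toLp _
        nlinarith [mul_le_mul_of_nonneg_left this
          (mul_nonneg (abs_nonneg (h θ)) (Nat.cast_nonneg (α := ℝ) (Fintype.card p)))]
    _ ≤ ∫ θ in Icc a b, Fintype.card p * (|h θ| * ‖ofFun a b f θ‖) :=
        setIntegral_mono_set h3 (ae_of_all _ fun θ => by positivity) hsub.eventuallyLE
    _ ≤ Fintype.card p * ‖hh.abs.toLp _‖ * ‖ofFun a b f‖ := by
        rw [integral_const_mul, mul_assoc]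
        exact mul_le_mul_of_nonneg_left h2 (Nat.cast_nonneg _)

lemma exists_entry_bound {M : ℝ → Matrix m p ℝ} (hM : Continuous M) (x y : ℝ) :
    ∃ C : ℝ, 0 ≤ C ∧ ∀ r ∈ Icc x y, ∀ i j, |M r i j| ≤ C := by
  have h (i : m) (j : p) := isCompact_Icc.exists_bound_of_continuousOn (s := Icc x y)
    (hM.matrix_elem i j).continuousOn
  choose C hC using h
  refine ⟨∑ i, ∑ j, |C i j|, by positivity, fun r hr i j => (hC i j r hr).trans ?_⟩
  refine (le_abs_self _).trans ((Finset.single_le_sum (f := fun j => |C i j|)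
    (fun j _ => abs_nonneg _) (Finset.mem_univ j)).trans ?_)
  exact Finset.single_le_sum (f := fun i => ∑ j, |C i j|)
    (fun i _ => Finset.sum_nonneg fun j _ => abs_nonneg _) (Finset.mem_univ i)

lemma exists_mulVec_bound (A : Matrix m p ℝ) :
    ∃ C : ℝ, 0 ≤ C ∧ ∀ v, ‖A *ᵥ v‖ ≤ C * ‖v‖ := by
  obtain ⟨C, hC, h⟩ := exists_entry_bound (M := fun _ => A) continuous_const 0 0
  exact ⟨C * Fintype.card p, by positivity, mulVec_norm_le hC (h 0 (by simp))⟩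

lemma norm_pairRL2_sq (x : m → ℝ) (f : L2Space a b p) :
    ‖pairRL2 a b x f‖ ^ 2 = ‖(WithLp.toLp 2 x : EuclideanSpace ℝ m)‖ ^ 2 + ‖f‖ ^ 2 :=
  WithLp.prod_norm_sq_eq_of_L2 _

lemma norm_fst_le_pairRL2 (x : m → ℝ) (f : L2Space a b p) :
    ‖(WithLp.toLp 2 x : EuclideanSpace ℝ m)‖ ≤ ‖pairRL2 a b x f‖ :=
  le_of_sq_le_sq (by rw [norm_pairRL2_sq]; nlinarith [sq_nonneg ‖f‖]) (norm_nonneg _)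

lemma norm_snd_le_pairRL2 (x : m → ℝ) (f : L2Space a b p) : ‖f‖ ≤ ‖pairRL2 a b x f‖ :=
  le_of_sq_le_sq (by
    rw [norm_pairRL2_sq]
    nlinarith [sq_nonneg ‖(WithLp.toLp 2 x : EuclideanSpace ℝ m)‖]) (norm_nonneg _)

lemma norm_pairRL2_le (x : m → ℝ) (f : L2Space a b p) :
    ‖pairRL2 a b x f‖ ≤ ‖(WithLp.toLp 2 x : EuclideanSpace ℝ m)‖ + ‖f‖ := by
  refine le_of_sq_le_sq ?_ (by positivity)
  rw [norm_pairRL2_sq]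
  nlinarith [mul_nonneg (norm_nonneg (WithLp.toLp 2 x : EuclideanSpace ℝ m)) (norm_nonneg f)]

/-- `ℝL₂` as a product space. -/
def pairCLE (a b : ℝ) (m p : Type) [Fintype m] [Fintype p] :
    ((m → ℝ) × L2Space a b p) ≃L[ℝ] RL2 a b m p :=
  ((EuclideanSpace.equiv m ℝ).symm.prodCongr (ContinuousLinearEquiv.refl ℝ _)).trans
    (WithLp.prodContinuousLinearEquiv 2 ℝ _ _).symm

lemma pairCLE_apply (x : m → ℝ) (f : L2Space a b p) : pairCLE a b m p (x, f) = pairRL2 a b x f :=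
  rfl

lemma pairCLE_symm_apply (x : m → ℝ) (f : L2Space a b p) :
    (pairCLE a b m p).symm (pairRL2 a b x f) = (x, f) := by
  rw [← pairCLE_apply, ContinuousLinearEquiv.symm_apply_apply]

lemma hasDerivAt_pairRL2_iff {x : ℝ → m → ℝ} {f : ℝ → L2Space a b p} {x' : m → ℝ}
    {f' : L2Space a b p} :
    HasDerivAt (fun t => pairRL2 a b (x t) (f t)) (pairRL2 a b x' f') t ↔
      HasDerivAt x x' t ∧ HasDerivAt f f' t := by
  constructor
  · intro h
    have h1 := (pairCLE a b m p).symm.hasFDerivAt.comp_hasDerivAt t h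
    rw [ContinuousLinearEquiv.coe_coe, pairCLE_symm_apply] at h1
    have h2 : HasDerivAt (fun t => (x t, f t)) (x', f') t := by
      refine h1.congr_of_eventuallyEq (Filter.Eventually.of_forall fun t => ?_)
      exact (pairCLE_symm_apply _ _).symm
    exact ⟨(ContinuousLinearMap.fst ℝ (m → ℝ) (L2Space a b p)).hasFDerivAt.comp_hasDerivAt t h2,
      (ContinuousLinearMap.snd ℝ (m → ℝ) (L2Space a b p)).hasFDerivAt.comp_hasDerivAt t h2⟩
  · rintro ⟨h1, h2⟩
    exact (pairCLE a b m p).hasFDerivAt.comp_hasDerivAt t (h1.prodMk h2)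

lemma locAC_pairRL2_iff {x : ℝ → m → ℝ} {f : ℝ → L2Space a b p} :
    LocAC (fun t => pairRL2 a b (x t) (f t)) ↔ LocAC x ∧ LocAC f := by
  constructor
  · intro h
    constructor
    · intro τ hτ
      have := (h τ hτ).comp_lipschitz (((ContinuousLinearMap.fst ℝ (m → ℝ) (L2Space a b p)).comp
        (pairCLE a b m p).symm.toContinuousLinearMap).lipschitz)
      exact this.congr fun t _ => congrArg Prod.fst (pairCLE_symm_apply (x t) (f t))
    · intro τ hτ
      have := (h τ hτ).comp_lipschitz (((ContinuousLinearMap.snd ℝ (m → ℝ) (L2Space a b p)).comp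
        (pairCLE a b m p).symm.toContinuousLinearMap).lipschitz)
      exact this.congr fun t _ => congrArg Prod.snd (pairCLE_symm_apply (x t) (f t))
  · rintro ⟨h1, h2⟩ τ hτ
    have h1' := (h1 τ hτ).comp_lipschitz (((pairCLE a b m p).toContinuousLinearMap.comp
      (ContinuousLinearMap.inl ℝ (m → ℝ) (L2Space a b p))).lipschitz)
    have h2' := (h2 τ hτ).comp_lipschitz (((pairCLE a b m p).toContinuousLinearMap.comp
      (ContinuousLinearMap.inr ℝ (m → ℝ) (L2Space a b p))).lipschitz)
    refine (h1'.add h2').congr fun t _ => ?_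
    change pairCLE a b m p (x t, 0) + pairCLE a b m p (0, f t) = pairCLE a b m p (x t, f t)
    rw [← map_add]
    simp

lemma pairRL2_eta (X : RL2 a b m p) : pairRL2 a b X.fst.ofLp X.snd = X := rfl

lemma pairRL2_eq_finRL2 (x : m → ℝ) (f : L2Space a b (Fin 0)) : pairRL2 a b x f = finRL2 a b x := by
  have : f = 0 := Lp.ext (ae_of_all _ fun s => Subsingleton.elim _ _)
  rw [this, finRL2]

lemma finRL2_injective {x y : m → ℝ} (h : finRL2 a b x = finRL2 a b y) : x = y :=
  congrArg (fun X : RL2 a b m (Fin 0) => X.fst.ofLp) h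

/-- Removes every input term from the PIE when `w = 0` and `u = 0`, whatever the regularity of the
parameters. -/
lemma FourPI.apply_finRL2_zero (K : FourPI m q p (Fin 0)) : K.apply a b (finRL2 a b 0) = 0 := by
  have h : (fun s => ((finRL2 a b (0 : q → ℝ)).snd s).ofLp) = fun _ => (0 : Fin 0 → ℝ) := by
    funext s; exact Subsingleton.elim _ _
  have h1 : (finRL2 a b (0 : q → ℝ)).fst.ofLp = 0 := rfl
  rw [FourPI.apply, h, h1]
  have e1 : K.fin a b 0 (fun _ => 0) = 0 := by simp [FourPI.fin]
  have e2 : K.fn a b 0 (fun _ => 0) = fun _ => 0 := by funext s; simp [FourPI.fn]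
  rw [e1, e2, ofFun_zero]
  rfl

end L2

/-! ### Correspondence between the GPDE and the PIE -/

section Map

variable {N : ℕ} {n : Fin (N + 1) → ℕ} {nx nw nu nr nz ny nv nBC : ℕ} {a b : ℝ}
  {Go : ODEParams nx nw nu nr nz ny nv} {Gb : BCParams n nBC nv} {Gp : PDEParams n nv nr}

/-- `X ∈ ℝL₂` consists of `x` and `𝒟 x̂`, where `x̂` satisfies the boundary conditions. -/
structure Corresponds (a b : ℝ) (Go : ODEParams nx nw nu nr nz ny nv) (Gb : BCParams n nBC nv)
    (X : RL2 a b (Fin nx) (StateIdx n)) (x : Fin nx → ℝ) (xh : ℝ → StateIdx n → ℝ) : Prop where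
  mem : xh ∈ Xset a b Gb (Go.Cv *ᵥ x)
  eq : X = pairRL2 a b x (ofFun a b (topDerivs a b xh))

/-! ### The image of a state under the operators of the PIE -/

section Operators

variable {X : RL2 a b (Fin nx) (StateIdx n)} {x : Fin nx → ℝ} {xh : ℝ → StateIdx n → ℝ}

lemma Corresponds.fst_eq (h : Corresponds a b Go Gb X x xh) : X.fst.ofLp = x := by
  rw [h.eq]; rfl

lemma Corresponds.snd_ae (h : Corresponds a b Go Gb X x xh) :
    (fun s => (X.snd s).ofLp) =ᵐ[leb a b] topDerivs a b xh := by
  rw [h.eq]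
  exact ofFun_coe_ae h.mem.1.l2Vec

lemma Corresponds.T_apply (hab : a ≤ b) (hGb : Gb.Regular a b) (hadm : Admissible a b Gb)
    (h : Corresponds a b Go Gb X x xh) :
    (assocPIE a b Go Gb Gp).T.apply a b X = pairRL2 a b x (ofFun a b xh) := by
  rw [FourPI.apply, h.fst_eq]
  congr 1
  · simp [FourPI.fin, assocPIE]
  · refine ofFun_congr ((FourPI.fn_congr_ae hab _ _ h.snd_ae).trans ?_)
    filter_upwards [ae_mem_leb] with s hs
    exact assocPIE_T_fn Go Gp hGb hadm h.mem hs

lemma subPIE_fin (hab : a ≤ b) (hGb : Gb.Regular a b) (hGp : Gp.Regular a b)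
    (hadm : Admissible a b Gb) {v : Fin nv → ℝ} (h : xh ∈ Xset a b Gb v) :
    (subPIE a b Gb Gp).fin a b v (topDerivs a b xh) = pdeOutput a b Gp xh ∧
      Integrable (fun s => (subPIE a b Gb Gp).Q₁ s *ᵥ topDerivs a b xh s) (leb a b) := by
  have hCr : L2Mat a b (Xi Gp).Q₁ := fun i j =>
    (hGp.2.2.2.2.2 i j).mono_exponent le_top
  obtain ⟨h1, h2⟩ := FourPI.fin_comp hab hCr (regular_Upsilon hab hGb) v h.1.l2Vec
  refine ⟨?_, h2⟩
  rw [subPIE, ← h1, Upsilon_fin hab hGb hadm h, FourPI.fin_congr_ae hab _ _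
    (ae_mem_leb.mono fun s hs => Upsilon_fn hGb hadm h hs)]
  simp [FourPI.fin, Xi, pdeOutput]

lemma subPIE_fn (hab : a ≤ b) (hGb : Gb.Regular a b) (hGp : Gp.Regular a b)
    (hadm : Admissible a b Gb) {v : Fin nv → ℝ} (h : xh ∈ Xset a b Gb v) :
    (subPIE a b Gb Gp).fn a b v (topDerivs a b xh) =ᵐ[leb a b] pdeRHS a b Gp v xh := by
  have hsec {A : ℝ → ℝ → Matrix (StateIdx n) (FIdx n) ℝ}
      (hA : ∀ i j, MemLp (fun s : ℝ × ℝ => A s.1 s.2 i j) ⊤ ((leb a b).prod (leb a b))) :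
      ∀ᵐ s ∂leb a b, L2Mat a b (A s) := by
    refine ae_all_iff.2 fun i => ae_all_iff.2 fun j => ?_
    -- The essential supremum over the square is finite and bounds almost every section almost
    -- everywhere.
    have hb := Measure.ae_ae_of_ae_prod (ae_le_eLpNormEssSup (μ := (leb a b).prod (leb a b))
      (f := fun s : ℝ × ℝ => A s.1 s.2 i j))
    filter_upwards [(hA i j).1.prodMk_left, hb] with s h1 h2
    have hlt := (hA i j).2
    rw [eLpNorm_exponent_top] at hlt
    have : MemLp (fun θ => A s θ i j) ⊤ (leb a b) := by
      refine ⟨h1, ?_⟩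
      rw [eLpNorm_exponent_top]
      exact lt_of_le_of_lt (eLpNormEssSup_le_of_ae_enorm_bound h2) hlt
    exact this.mono_exponent le_top
  have h1 := FourPI.fn_comp (K := Xi Gp) hab (hsec hGp.2.1) (hsec hGp.2.2.1)
    (regular_Upsilon hab hGb) v h.1.l2Vec
  refine h1.symm.trans ?_
  rw [Upsilon_fin hab hGb hadm h]
  refine (FourPI.fn_congr_ae hab _ _
    (ae_mem_leb.mono fun s hs => Upsilon_fn hGb hadm h hs)).trans ?_
  refine ae_of_all _ fun s => ?_
  simp only [FourPI.fn, Xi, pdeRHS, Matrix.fromCols_mulVec_sumElim]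
  abel

/-- Finite-dimensional outputs of the PIE. -/
lemma Corresponds.output (hab : a ≤ b) (hGb : Gb.Regular a b) (hGp : Gp.Regular a b)
    (hadm : Admissible a b Gb) (h : Corresponds a b Go Gb X x xh) {κ : Type} [Fintype κ]
    (C : Matrix κ (Fin nx) ℝ) (E : Matrix κ (Fin nr) ℝ) :
    ((C + E * (subPIE a b Gb Gp).P * Go.Cv) *ᵥ X.fst.ofLp +
      ∫ θ in a..b, (E * (subPIE a b Gb Gp).Q₁ θ) *ᵥ (X.snd θ).ofLp) =
    C *ᵥ x + E *ᵥ pdeOutput a b Gp xh := by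
  obtain ⟨h1, h2⟩ := subPIE_fin hab hGb hGp hadm h.mem
  have e : (fun θ => (E * (subPIE a b Gb Gp).Q₁ θ) *ᵥ (X.snd θ).ofLp) =ᵐ[leb a b]
      fun θ => E *ᵥ ((subPIE a b Gb Gp).Q₁ θ *ᵥ topDerivs a b xh θ) :=
    h.snd_ae.mono fun θ hθ => by simp only [hθ, Matrix.mulVec_mulVec]
  rw [intervalIntegral_congr_leb e (left_mem_Icc.2 hab) (right_mem_Icc.2 hab),
    ← mulVec_intervalIntegral _
      (intervalIntegrable_of_mem h2 (left_mem_Icc.2 hab) (right_mem_Icc.2 hab)),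
    h.fst_eq, ← h1, FourPI.fin, Matrix.add_mulVec, Matrix.mulVec_add, Matrix.mulVec_mulVec,
    Matrix.mulVec_mulVec, add_assoc]

lemma Corresponds.A_apply (hab : a ≤ b) (hGb : Gb.Regular a b) (hGp : Gp.Regular a b)
    (hadm : Admissible a b Gb) (h : Corresponds a b Go Gb X x xh) :
    (assocPIE a b Go Gb Gp).A.apply a b X = pairRL2 a b
      (Go.A *ᵥ x + Go.Bxr *ᵥ pdeOutput a b Gp xh)
      (ofFun a b (pdeRHS a b Gp (Go.Cv *ᵥ x) xh)) := by
  rw [FourPI.apply, ← h.output hab hGb hGp hadm]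
  congr 1
  refine ofFun_congr ((FourPI.fn_congr_ae hab _ _ h.snd_ae).trans ?_)
  refine Filter.EventuallyEq.trans ?_ (subPIE_fn hab hGb hGp hadm h.mem)
  refine ae_of_all _ fun s => ?_
  rw [h.fst_eq]
  simp only [FourPI.fn, assocPIE, Matrix.mulVec_mulVec]

lemma Corresponds.C₁_apply (hab : a ≤ b) (hGb : Gb.Regular a b) (hGp : Gp.Regular a b)
    (hadm : Admissible a b Gb) (h : Corresponds a b Go Gb X x xh) :
    (assocPIE a b Go Gb Gp).C₁.apply a b X =
      finRL2 a b (Go.Cz *ᵥ x + Go.Dzr *ᵥ pdeOutput a b Gp xh) := by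
  rw [FourPI.apply, ← h.output hab hGb hGp hadm, pairRL2_eq_finRL2]
  rfl

lemma Corresponds.C₂_apply (hab : a ≤ b) (hGb : Gb.Regular a b) (hGp : Gp.Regular a b)
    (hadm : Admissible a b Gb) (h : Corresponds a b Go Gb X x xh) :
    (assocPIE a b Go Gb Gp).C₂.apply a b X =
      finRL2 a b (Go.Cy *ᵥ x + Go.Dyr *ᵥ pdeOutput a b Gp xh) := by
  rw [FourPI.apply, ← h.output hab hGb hGp hadm, pairRL2_eq_finRL2]
  rfl

end Operators

/-! ### Equivalence of the norms -/

/-- The boundary conditions bound `(𝒞 x̂)(a)` by `‖X‖`, and Taylor's formula carries the bound to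
all of `[a,b]`. -/
lemma exists_contDerivs_bound (hab : a ≤ b) (hGb : Gb.Regular a b) (hadm : Admissible a b Gb)
    (Go : ODEParams nx nw nu nr nz ny nv) :
    ∃ K : ℝ, 0 ≤ K ∧ ∀ X x xh, Corresponds a b Go Gb X x xh → ∀ s ∈ Icc a b,
      ‖contDerivs a b xh s‖ ≤ K * ‖X‖ := by
  have hBQ := l2Mat_BQ hab hGb
  have hh : MemLp (fun θ => ∑ i, ∑ j, |BQ a b Gb θ i j|) 2 (leb a b) :=
    memLp_finsetSum _ fun i _ => memLp_finsetSum _ fun j _ => (hBQ i j).abs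
  obtain ⟨C₁, hC₁, h₁⟩ := exists_integral_mulVec_bound (m := CIdx n) (p := StateIdx n) hh
  obtain ⟨C₂, hC₂, h₂⟩ := exists_mulVec_bound (BTinv a b Gb * Gb.Bv * Go.Cv)
  obtain ⟨C₃, hC₃, h₃⟩ := exists_entry_bound (continuous_Tmat (n := n)) 0 (b - a)
  -- Arguments down to `a - b` are needed: the integral bound asks for domination at all `θ ∈
  -- [a,b]`, although only `θ ≤ s` is integrated.
  obtain ⟨C₄, hC₄, h₄⟩ := exists_entry_bound (continuous_Qmat (n := n)) (a - b) (b - a)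
  obtain ⟨C₅, hC₅, h₅⟩ := exists_integral_mulVec_bound (m := CIdx n) (p := StateIdx n)
    (a := a) (b := b) (memLp_const C₄)
  refine ⟨C₃ * Fintype.card (CIdx n) * (C₂ + C₁) + C₅, by positivity,
    fun X x xh h s hs => ?_⟩
  have ha := left_mem_Icc.2 hab
  have hb := right_mem_Icc.2 hab
  have hf := h.mem.1.l2Vec
  have hn₁ : ‖x‖ ≤ ‖X‖ := by
    rw [h.eq]; exact (norm_le_norm_toLp x).trans (norm_fst_le_pairRL2 _ _)
  have hn₂ : ‖ofFun a b (topDerivs a b xh)‖ ≤ ‖X‖ := by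
    rw [h.eq]; exact norm_snd_le_pairRL2 _ _
  have hc : ‖contDerivs a b xh a‖ ≤ (C₂ + C₁) * ‖X‖ := by
    rw [(mem_Xset_iff hab hGb hadm h.mem.1 _).1 h.mem, bcInit, Matrix.mulVec_mulVec, add_mul]
    refine (norm_add_le _ _).trans (add_le_add ?_ ?_)
    · exact (h₂ x).trans (mul_le_mul_of_nonneg_left hn₁ hC₂)
    · refine (h₁ _ (fun θ _ i j => ?_) _ hf a ha b hb).trans (mul_le_mul_of_nonneg_left hn₂ hC₁)
      refine le_trans ?_ (le_abs_self _)
      exact (Finset.single_le_sum (f := fun j => |BQ a b Gb θ i j|)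
        (fun j _ => abs_nonneg _) (Finset.mem_univ j)).trans
        (Finset.single_le_sum (f := fun i => ∑ j, |BQ a b Gb θ i j|)
          (fun i _ => Finset.sum_nonneg fun j _ => abs_nonneg _) (Finset.mem_univ i))
  rw [contDerivs_eq h.mem.1 hs, add_mul]
  refine (norm_add_le _ _).trans (add_le_add ?_ ?_)
  · refine (mulVec_norm_le hC₃ (h₃ (s - a) ⟨by linarith [hs.1], by linarith [hs.2]⟩) _).trans ?_
    rw [mul_assoc (C₃ * _)]
    exact mul_le_mul_of_nonneg_left hc (by positivity)
  · refine (h₅ _ (fun θ hθ i j => ?_) _ hf a ha s hs).trans (mul_le_mul_of_nonneg_left hn₂ hC₅)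
    rw [abs_of_nonneg hC₄]
    exact h₄ _ ⟨by linarith [hs.1, hθ.2], by linarith [hs.2, hθ.1]⟩ i j

/-- The `Wⁿ` norm is dominated by the norm in `ℝL₂`. -/
theorem exists_wNorm_le (hab : a ≤ b) (hGb : Gb.Regular a b) (hadm : Admissible a b Gb)
    (Go : ODEParams nx nw nu nr nz ny nv) :
    ∃ C : ℝ, 0 < C ∧ ∀ X x xh, Corresponds a b Go Gb X x xh → wNorm a b x xh ≤ C * ‖X‖ := by
  obtain ⟨K, hK, hb⟩ := exists_contDerivs_bound hab hGb hadm Go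
  -- One constant serves both kinds of summands: the `1` is for the highest order `j = i`, which is
  -- a part of `X`, and `√(n i * (b - a)) * K` is for `j < i`, where the derivatives are bounded
  -- pointwise by `K ‖X‖`.
  have key (i : Fin (N + 1)) (j : ℕ) (hj : j ∈ Finset.range (i.val + 1)) :
      ∀ X x xh, Corresponds a b Go Gb X x xh →
        Real.sqrt (∑ l : Fin (n i), ∫ s in a..b,
          (iteratedDerivWithin j (fun σ => xh σ ⟨i, l⟩) (Icc a b) s) ^ 2) ≤
        (1 + Real.sqrt (n i * (b - a)) * K) * ‖X‖ := by
    intro X x xh h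
    have hba : 0 ≤ b - a := by linarith
    rcases (Nat.lt_succ_iff.1 (Finset.mem_range.1 hj)).eq_or_lt with rfl | hlt
    · have h1 : (∑ l : Fin (n i), ∫ s in a..b,
          (iteratedDerivWithin i (fun σ => xh σ ⟨i, l⟩) (Icc a b) s) ^ 2) ≤
          ‖ofFun a b (topDerivs a b xh)‖ ^ 2 := by
        rw [norm_ofFun_sq hab h.mem.1.l2Vec, Fintype.sum_sigma]
        refine Finset.single_le_sum (f := fun i : Fin (N + 1) => ∑ l : Fin (n i), ∫ s in a..b,
          topDerivs a b xh s ⟨i, l⟩ ^ 2) (fun i _ => Finset.sum_nonneg fun l _ =>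
          intervalIntegral.integral_nonneg hab fun s _ => sq_nonneg _) (Finset.mem_univ i)
      refine (Real.sqrt_le_sqrt h1).trans ?_
      rw [Real.sqrt_sq (norm_nonneg _), add_mul, one_mul]
      have : ‖ofFun a b (topDerivs a b xh)‖ ≤ ‖X‖ := by
        rw [h.eq]; exact norm_snd_le_pairRL2 _ _
      exact this.trans (le_add_of_nonneg_right (by positivity))
    · have h1 (l : Fin (n i)) : (∫ s in a..b,
          (iteratedDerivWithin j (fun σ => xh σ ⟨i, l⟩) (Icc a b) s) ^ 2) ≤
          (b - a) * (K * ‖X‖) ^ 2 := by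
        have hle := intervalIntegral.norm_integral_le_of_norm_le_const (a := a) (b := b)
          (C := (K * ‖X‖) ^ 2)
          (f := fun s => (iteratedDerivWithin j (fun σ => xh σ ⟨i, l⟩) (Icc a b) s) ^ 2) ?_
        · rw [abs_of_nonneg hba, mul_comm] at hle
          exact (le_abs_self _).trans hle
        · intro s hs
          rw [uIoc_of_le hab] at hs
          rw [norm_pow]
          refine pow_le_pow_left₀ (norm_nonneg _) ?_ 2
          exact (norm_le_pi_norm (contDerivs a b xh s) ⟨⟨i, l⟩, ⟨j, hlt⟩⟩).trans
            (hb X x xh h s (Ioc_subset_Icc_self hs))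
      have h2 : (∑ l : Fin (n i), ∫ s in a..b,
          (iteratedDerivWithin j (fun σ => xh σ ⟨i, l⟩) (Icc a b) s) ^ 2) ≤
          n i * (b - a) * (K * ‖X‖) ^ 2 := by
        refine (Finset.sum_le_sum fun l _ => h1 l).trans (le_of_eq ?_)
        simp [mul_assoc]
      refine (Real.sqrt_le_sqrt h2).trans ?_
      rw [Real.sqrt_mul (by positivity), Real.sqrt_sq (by positivity), add_mul, mul_assoc]
      exact le_add_of_nonneg_left (by positivity)
  -- The leading `1` accounts for `|x|` and makes the constant positive.
  refine ⟨1 + ∑ i : Fin (N + 1), ∑ j ∈ Finset.range (i.val + 1),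
    (1 + Real.sqrt (n i * (b - a)) * K), by positivity, fun X x xh h => ?_⟩
  rw [wNorm, add_mul, one_mul, Finset.sum_mul]
  refine add_le_add ?_ (Finset.sum_le_sum fun i _ => ?_)
  · rw [h.eq]; exact norm_fst_le_pairRL2 _ _
  · rw [Finset.sum_mul]
    exact Finset.sum_le_sum fun j hj => key i j hj X x xh h

/-- The norm in `ℝL₂` is dominated by the `Wⁿ` norm. -/
theorem Corresponds.norm_le (hab : a ≤ b) {X : RL2 a b (Fin nx) (StateIdx n)} {x : Fin nx → ℝ}
    {xh : ℝ → StateIdx n → ℝ} (h : Corresponds a b Go Gb X x xh) : ‖X‖ ≤ wNorm a b x xh := by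
  rw [h.eq, wNorm]
  refine (norm_pairRL2_le _ _).trans (add_le_add_right ?_ _)
  have h1 : ‖ofFun a b (topDerivs a b xh)‖ ^ 2 = ∑ i : Fin (N + 1), Real.sqrt (∑ l : Fin (n i),
      ∫ s in a..b, (iteratedDerivWithin i (fun σ => xh σ ⟨i, l⟩) (Icc a b) s) ^ 2) ^ 2 := by
    rw [norm_ofFun_sq hab h.mem.1.l2Vec, Fintype.sum_sigma]
    refine Finset.sum_congr rfl fun i _ => ?_
    rw [Real.sq_sqrt (Finset.sum_nonneg fun l _ =>
      intervalIntegral.integral_nonneg hab fun s _ => sq_nonneg _)]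
    rfl
  have h2 : ‖ofFun a b (topDerivs a b xh)‖ ≤ ∑ i : Fin (N + 1), Real.sqrt (∑ l : Fin (n i),
      ∫ s in a..b, (iteratedDerivWithin i (fun σ => xh σ ⟨i, l⟩) (Icc a b) s) ^ 2) := by
    refine le_of_sq_le_sq ?_ (Finset.sum_nonneg fun i _ => Real.sqrt_nonneg _)
    rw [h1]
    -- The block norms combine in `ℓ²` in the norm of `ℝL₂`, but in `ℓ¹` in the `Wⁿ` norm.
    exact Finset.sum_sq_le_sq_sum_of_nonneg fun i _ => Real.sqrt_nonneg _
  refine h2.trans (Finset.sum_le_sum fun i _ => ?_)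
  exact Finset.single_le_sum (f := fun j => Real.sqrt (∑ l : Fin (n i),
    ∫ s in a..b, (iteratedDerivWithin j (fun σ => xh σ ⟨i, l⟩) (Icc a b) s) ^ 2))
    (fun j _ => Real.sqrt_nonneg _) (Finset.self_mem_range_succ i.val)

/-! ### Construction of a state from its highest derivatives -/

/-- The function with `𝒟 x̂ = f` and `(𝒞 x̂)(a) = c`. -/
def lift (a b : ℝ) (f : ℝ → StateIdx n → ℝ) (c : CIdx n → ℝ) (s : ℝ) (i : StateIdx n) : ℝ :=
  -- Extension by zero makes the function integrable on the whole line, as the facts on iterated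
  -- primitives require.
  prim a ((Icc a b).indicator fun s => f s i)
    (fun m => if h : m < i.1.val then c ⟨i, ⟨i.1.val - 1 - m, by omega⟩⟩ else 0) i.1.val s

section Lift

variable {f : ℝ → StateIdx n → ℝ} (c : CIdx n → ℝ)

lemma L2Vec.integrable_indicator (hf : L2Vec a b f) (i : StateIdx n) :
    Integrable ((Icc a b).indicator fun s => f s i) :=
  (integrable_indicator_iff measurableSet_Icc).2 (MemLp.integrable_leb (hf i))

lemma indicator_ae_eq (i : StateIdx n) :
    ((Icc a b).indicator fun s => f s i) =ᵐ[leb a b] fun s => f s i :=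
  indicator_ae_eq_restrict measurableSet_Icc

lemma memWn_lift (hab : a < b) (hf : L2Vec a b f) : MemWn a b (lift a b f c) := fun i =>
  memW_prim hab (hf.integrable_indicator i) ((memLp_congr_ae (indicator_ae_eq i)).2 (hf i)) _

lemma topDerivs_lift (hab : a < b) (hf : L2Vec a b f) :
    topDerivs a b (lift a b f c) =ᵐ[leb a b] f := by
  have h : ∀ᵐ s ∂leb a b, ∀ i, topDerivs a b (lift a b f c) s i = f s i :=
    ae_all_iff.2 fun i =>
      (iteratedDerivWithin_prim_top hab (hf.integrable_indicator i) _).trans (indicator_ae_eq i)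
  exact h.mono fun s hs => funext hs

lemma contDerivs_lift (hab : a < b) (hf : L2Vec a b f) :
    contDerivs a b (lift a b f c) a = c := by
  ext ⟨i, j⟩
  obtain ⟨m, hm⟩ : ∃ m, i.1.val = m + 1 + j.val :=
    ⟨i.1.val - j.val - 1, by have := j.isLt; omega⟩
  have h := iteratedDerivWithin_prim (a := a) (b := b)
    (c := fun m => if h : m < i.1.val then c ⟨i, ⟨i.1.val - 1 - m, by omega⟩⟩ else 0)
    hab (hf.integrable_indicator i) j.val m (left_mem_Icc.2 hab.le)
  rw [← hm, prim_left, dif_pos (by omega)] at h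
  refine h.trans ?_
  congr 2
  ext
  simp only
  omega

end Lift

lemma bcInit_congr (hab : a ≤ b) (v : Fin nv → ℝ) {f g : ℝ → StateIdx n → ℝ}
    (h : f =ᵐ[leb a b] g) : bcInit a b Gb v f = bcInit a b Gb v g := by
  rw [bcInit, bcInit, intervalIntegral_congr_leb (g₂ := fun θ => BQ a b Gb θ *ᵥ g θ)
    (h.mono fun s hs => by simp only [hs]) (left_mem_Icc.2 hab) (right_mem_Icc.2 hab)]

/-- The state of the GPDE that corresponds to a state of the PIE. -/
def toState (a b : ℝ) (Go : ODEParams nx nw nu nr nz ny nv) (Gb : BCParams n nBC nv)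
    (X : RL2 a b (Fin nx) (StateIdx n)) : ℝ → StateIdx n → ℝ :=
  lift a b (fun s => (X.snd s).ofLp)
    (bcInit a b Gb (Go.Cv *ᵥ X.fst.ofLp) fun s => (X.snd s).ofLp)

/-- Every element of `ℝL₂` comes from a GPDE state. Since `𝒟` of the lifted function agrees with the
given function only almost everywhere, the boundary conditions hold because `bcInit` depends on the
class alone. -/
lemma corresponds_toState (hab : a < b) (hGb : Gb.Regular a b) (hadm : Admissible a b Gb)
    (X : RL2 a b (Fin nx) (StateIdx n)) :
    Corresponds a b Go Gb X X.fst.ofLp (toState a b Go Gb X) := by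
  have hf := l2Vec_coe X.snd
  have htop := topDerivs_lift
    (bcInit a b Gb (Go.Cv *ᵥ X.fst.ofLp) fun s => (X.snd s).ofLp) hab hf
  constructor
  · refine (mem_Xset_iff hab.le hGb hadm (memWn_lift _ hab hf) _).2 ?_
    exact (contDerivs_lift _ hab hf).trans (bcInit_congr hab.le _ htop).symm
  · rw [toState, ofFun_congr htop, ofFun_coe, pairRL2_eta]

lemma mem_XXset_zero {x : Fin nx → ℝ} {xh : ℝ → StateIdx n → ℝ} :
    (x, xh) ∈ XXset a b Go Gb 0 0 ↔ xh ∈ Xset a b Gb (Go.Cv *ᵥ x) := by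
  simp [XXset]

/-! ### Correspondence of the solutions -/

section Solutions

variable {X : ℝ → RL2 a b (Fin nx) (StateIdx n)} {x : ℝ → Fin nx → ℝ}
  {xh : ℝ → ℝ → StateIdx n → ℝ} {z : ℝ → Fin nz → ℝ} {y : ℝ → Fin ny → ℝ}

lemma memL2e_zero {E : Type} [NormedAddCommGroup E] : MemL2e fun _ : ℝ => (0 : E) :=
  fun _ _ => MemLp.zero'

lemma memW1e_zero {E : Type} [NormedAddCommGroup E] [NormedSpace ℝ E] :
    MemW1e fun _ : ℝ => (0 : E) := by
  refine ⟨fun τ _ => ?_, memL2e_zero, ?_⟩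
  · exact ((LipschitzWith.const (0 : E)).lipschitzOnWith).absolutelyContinuousOnInterval (K := 0)
  · simpa using memL2e_zero

lemma imageMemW1e_zero {p : Type} [Fintype p] {k : ℕ} (K : FourPI (Fin nx) (Fin k) p (Fin 0)) :
    ImageMemW1e a b K fun _ => 0 := by
  intro s _
  constructor
  · simpa [FourPI.fin] using memW1e_zero
  · simpa [FourPI.fn] using memW1e_zero

lemma LocAC.congr {E : Type} [PseudoMetricSpace E] {f g : ℝ → E} (hf : LocAC f)
    (h : ∀ t, 0 ≤ t → f t = g t) : LocAC g := fun τ hτ => (hf τ hτ).congr fun t ht => by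
  rw [uIcc_of_le hτ] at ht
  exact h t ht.1

lemma LocAC.memL2e {E : Type} [NormedAddCommGroup E] {f : ℝ → E} (hf : LocAC f) : MemL2e f := by
  intro τ hτ
  have hc := (hf τ hτ).continuousOn
  rw [uIcc_of_le hτ] at hc
  obtain ⟨C, hC⟩ := isCompact_Icc.exists_bound_of_continuousOn hc
  exact MemLp.of_bound (hc.aestronglyMeasurable_of_isCompact isCompact_Icc measurableSet_Icc) C
    ((ae_restrict_iff' measurableSet_Icc).2 (ae_of_all _ hC))

/-- The states correspond only for `t ≥ 0`, while `HasDerivAt` is two-sided. Discarding `t = 0`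
leaves times with a neighbourhood on which they correspond. -/
lemma ae_pos : ∀ᵐ t ∂volume.restrict (Ici (0 : ℝ)), 0 < t := by
  rw [← Measure.restrict_congr_set Ioi_ae_eq_Ici]
  exact ae_restrict_mem measurableSet_Ioi

/-- Since `𝒯 X = (x, x̂)` for all `t ≥ 0`, regularity in time is the same requirement on both sides;
eliminating `v` and `r` turns the GPDE into the PIE. -/
theorem pieSolution_of_gpdeSolution (hab : a < b) (hGb : Gb.Regular a b) (hGp : Gp.Regular a b)
    (hadm : Admissible a b Gb) {x₀ : Fin nx → ℝ} {xh₀ : ℝ → StateIdx n → ℝ}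
    {v : ℝ → Fin nv → ℝ} {r : ℝ → Fin nr → ℝ}
    (hX : ∀ t, 0 ≤ t → Corresponds a b Go Gb (X t) (x t) (xh t))
    (h : GPDESolution a b Go Gb Gp x₀ xh₀ (fun _ => 0) (fun _ => 0) x xh z y v r) :
    PIESolution a b (assocPIE a b Go Gb Gp) (X 0) (fun _ => 0) (fun _ => 0) X z y where
  memL2e_w := memL2e_zero
  memL2e_u := memL2e_zero
  memW1e_w := imageMemW1e_zero _
  memW1e_u := imageMemW1e_zero _
  memL2e_z := h.memL2e_z
  memL2e_y := h.memL2e_y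
  locAC_Tx := (locAC_pairRL2_iff.2 ⟨h.locAC_x, h.locAC_xh⟩).congr fun t ht =>
    ((hX t ht).T_apply hab.le hGb hadm).symm
  init := rfl
  pie := by
    filter_upwards [h.ode, h.pde, ae_pos] with t h1 h2 ht
    obtain ⟨h1x, h1z, h1y, h1v⟩ := h1
    obtain ⟨h2x, h2r⟩ := h2
    have hc := hX t ht.le
    simp only [Matrix.mulVec_zero, add_zero] at h1x h1z h1y h1v
    rw [h2r] at h1x h1z h1y
    rw [h1v] at h2x
    -- The derivative of `𝒯 X` is declared to be the right-hand side of the PIE, so the equation is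
    -- `rfl` and differentiability carries the content. The input terms are constant in time.
    refine ⟨_, 0, 0, ?_, ?_, ?_, rfl, ?_, ?_⟩
    · simp only [FourPI.apply_finRL2_zero, add_zero, sub_zero]
      rw [hc.A_apply hab.le hGb hGp hadm]
      refine (hasDerivAt_pairRL2_iff.2 ⟨h1x, h2x⟩).congr_of_eventuallyEq ?_
      filter_upwards [lt_mem_nhds ht] with t' ht'
      exact (hX t' ht'.le).T_apply hab.le hGb hadm
    · exact hasDerivAt_const _ _
    · exact hasDerivAt_const _ _
    · rw [hc.C₁_apply hab.le hGb hGp hadm]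
      simp only [FourPI.apply_finRL2_zero, add_zero, h1z]
    · rw [hc.C₂_apply hab.le hGb hGp hadm]
      simp only [FourPI.apply_finRL2_zero, add_zero, h1y]

/-- The signals `v` and `r` have no counterpart in the PIE and are recomputed from the state. -/
theorem gpdeSolution_of_pieSolution (hab : a < b) (hGb : Gb.Regular a b) (hGp : Gp.Regular a b)
    (hadm : Admissible a b Gb) {X₀ : RL2 a b (Fin nx) (StateIdx n)}
    (hX : ∀ t, 0 ≤ t → Corresponds a b Go Gb (X t) (x t) (xh t))
    (h : PIESolution a b (assocPIE a b Go Gb Gp) X₀ (fun _ => 0) (fun _ => 0) X z y) :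
    GPDESolution a b Go Gb Gp (x 0) (xh 0) (fun _ => 0) (fun _ => 0) x xh z y
      (fun t => Go.Cv *ᵥ x t) (fun t => pdeOutput a b Gp (xh t)) := by
  have hAC : LocAC x ∧ LocAC fun t => ofFun a b (xh t) :=
    locAC_pairRL2_iff.1 (h.locAC_Tx.congr fun t ht => (hX t ht).T_apply hab.le hGb hadm)
  have hpie : ∀ᵐ t ∂volume.restrict (Ici (0 : ℝ)),
      HasDerivAt x (Go.A *ᵥ x t + Go.Bxr *ᵥ pdeOutput a b Gp (xh t)) t ∧
      HasDerivAt (fun t' => ofFun a b (xh t'))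
        (ofFun a b (pdeRHS a b Gp (Go.Cv *ᵥ x t) (xh t))) t ∧
      z t = Go.Cz *ᵥ x t + Go.Dzr *ᵥ pdeOutput a b Gp (xh t) ∧
      y t = Go.Cy *ᵥ x t + Go.Dyr *ᵥ pdeOutput a b Gp (xh t) := by
    filter_upwards [h.pie, ae_pos] with t ht h0
    obtain ⟨dTx, dTw, dTu, h1, h2, h3, h4, h5, h6⟩ := ht
    have hc := hX t h0.le
    simp only [FourPI.apply_finRL2_zero] at h2 h3
    have e2 := h2.unique (hasDerivAt_const _ _)
    have e3 := h3.unique (hasDerivAt_const _ _)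
    simp only [FourPI.apply_finRL2_zero, add_zero, sub_zero, e2, e3] at h4 h5 h6
    rw [hc.A_apply hab.le hGb hGp hadm] at h4
    rw [hc.C₁_apply hab.le hGb hGp hadm] at h5
    rw [hc.C₂_apply hab.le hGb hGp hadm] at h6
    have h7 : HasDerivAt (fun t' => pairRL2 a b (x t') (ofFun a b (xh t'))) dTx t := by
      refine h1.congr_of_eventuallyEq ?_
      filter_upwards [lt_mem_nhds h0] with t' ht'
      exact ((hX t' ht'.le).T_apply hab.le hGb hadm).symm
    rw [h4, hasDerivAt_pairRL2_iff] at h7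
    exact ⟨h7.1, h7.2, finRL2_injective h5, finRL2_injective h6⟩
  constructor
  · exact memL2e_zero
  · exact memL2e_zero
  · simpa using memW1e_zero
  · simpa using memW1e_zero
  · exact h.memL2e_z
  · exact h.memL2e_y
  · refine LocAC.memL2e fun τ hτ => ?_
    exact (hAC.1 τ hτ).comp_lipschitz
      (LinearMap.toContinuousLinearMap (Matrix.mulVecLin Go.Cv)).lipschitz
  · exact fun t ht => mem_XXset_zero.2 (hX t ht).mem
  · exact hAC.1
  · exact hAC.2
  · rfl
  · rfl
  · filter_upwards [hpie] with t ht
    simp only [Matrix.mulVec_zero, add_zero, and_true]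
    exact ⟨ht.1, ht.2.2.1, ht.2.2.2⟩
  · filter_upwards [hpie] with t ht
    exact ⟨ht.2.1, rfl⟩

end Solutions

end Map

end GPIE

end

/-! ### Transfer of stability through the norm equivalence -/

theorem corollary5 {N : ℕ} (n : Fin (N + 1) → ℕ) {nx nw nu nr nz ny nv nBC : ℕ}
    (a b : ℝ) (hab : a < b)
    (Go : GPIE.ODEParams nx nw nu nr nz ny nv) (Gb : GPIE.BCParams n nBC nv)
    (Gp : GPIE.PDEParams n nv nr)
    (hGb : Gb.Regular a b) (hGp : Gp.Regular a b) (hadm : GPIE.Admissible a b Gb) :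
    (GPIE.GPDELyapunovStable a b Go Gb Gp ↔
      GPIE.PIELyapunovStable a b (GPIE.assocPIE a b Go Gb Gp)) ∧
    (GPIE.GPDEAsymptoticallyStable a b Go Gb Gp ↔
      GPIE.PIEAsymptoticallyStable a b (GPIE.assocPIE a b Go Gb Gp)) := by
  obtain ⟨C, hC, hle⟩ := GPIE.exists_wNorm_le hab.le hGb hadm Go
  have hstate (X : GPIE.RL2 a b (Fin nx) (GPIE.StateIdx n)) :=
    GPIE.corresponds_toState (Go := Go) hab hGb hadm X
  have hcorr {x xh} (h : xh ∈ GPIE.Xset a b Gb (Go.Cv *ᵥ x)) :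
      GPIE.Corresponds a b Go Gb (GPIE.pairRL2 a b x (GPIE.ofFun a b (GPIE.topDerivs a b xh)))
        x xh := ⟨h, rfl⟩
  refine ⟨⟨fun H ε hε => ?_, fun H ε hε => ?_⟩, ⟨fun H X₀ ε hε => ?_, fun H x₀ xh₀ h₀ ε hε => ?_⟩⟩
  · obtain ⟨δ, hδ, h⟩ := H ε hε
    -- The bound of the `Wⁿ` norm by `C ‖X‖` is spent on the initial state; at later times `‖X‖` is
    -- at most the `Wⁿ` norm without a constant.
    refine ⟨δ / C, div_pos hδ hC, fun X₀ hX₀ X z y hX t ht => ?_⟩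
    have hsol := GPIE.gpdeSolution_of_pieSolution hab hGb hGp hadm (fun t _ => hstate (X t)) hX
    refine lt_of_le_of_lt ((hstate (X t)).norm_le hab.le) (h _ _
      (GPIE.mem_XXset_zero.2 (hstate (X 0)).mem) ?_ _ _ _ _ _ _ hsol t ht)
    refine lt_of_le_of_lt (hle _ _ _ (hstate (X 0))) ?_
    rw [hX.init]
    rwa [lt_div_iff₀' hC] at hX₀
  · obtain ⟨δ, hδ, h⟩ := H (ε / C) (div_pos hε hC)
    refine ⟨δ, hδ, fun x₀ xh₀ h₀ hn x xh z y v r hx t ht => ?_⟩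
    have hc (t : ℝ) (ht : 0 ≤ t) := hcorr (GPIE.mem_XXset_zero.1 (hx.mem_domain t ht))
    have hsol := GPIE.pieSolution_of_gpdeSolution hab hGb hGp hadm hc hx
    refine lt_of_le_of_lt (hle _ _ _ (hc t ht)) ?_
    rw [← lt_div_iff₀' hC]
    refine h _ ?_ _ _ _ hsol t ht
    refine lt_of_le_of_lt ((hc 0 le_rfl).norm_le hab.le) ?_
    rwa [hx.init_x, hx.init_xh]
  · obtain ⟨Tε, hT, h⟩ := H X₀.fst.ofLp (GPIE.toState a b Go Gb X₀)
      (GPIE.mem_XXset_zero.2 (hstate X₀).mem) ε hε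
    refine ⟨Tε, hT, fun X z y hX t ht => ?_⟩
    have hsol := GPIE.gpdeSolution_of_pieSolution hab hGb hGp hadm (fun t _ => hstate (X t)) hX
    rw [hX.init] at hsol
    exact lt_of_le_of_lt ((hstate (X t)).norm_le hab.le) (h _ _ _ _ _ _ hsol t ht)
  · obtain ⟨Tε, hT, h⟩ := H
      (GPIE.pairRL2 a b x₀ (GPIE.ofFun a b (GPIE.topDerivs a b xh₀))) (ε / C) (div_pos hε hC)
    refine ⟨Tε, hT, fun x xh z y v r hx t ht => ?_⟩
    have hc (t : ℝ) (ht : 0 ≤ t) := hcorr (GPIE.mem_XXset_zero.1 (hx.mem_domain t ht))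
    have hsol := GPIE.pieSolution_of_gpdeSolution hab hGb hGp hadm hc hx
    rw [hx.init_x, hx.init_xh] at hsol
    refine lt_of_le_of_lt (hle _ _ _ (hc t (hT.trans ht).le)) ?_
    rw [← lt_div_iff₀' hC]
    exact h _ _ _ hsol t ht
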